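/- A graph $T=(V,F)$ is a threshold graph if there are $s\in\mathbb R$ and $w:V\to\mathbb R$ such that for all distinct $u,v\in V$: $uv\in F \iff w(u)+w(v)\ge s$. The threshold dimension $t(G)$ of a finite graph $G$ is the minimum number of threshold subgraphs of $G$ that cover $E(G)$. A graph is co-bipartite if its complement is bipartite. There is a polynomial-time algorithm that, given a co-bipartite graph $G$ on $n\ge 3$ vertices (by its adjacency matrix), computes a natural number $a(G)$ with $$t(G)\;\le\; a(G)\;\le\; 2\left\lceil \frac{n\sqrt{\log\log n}}{\sqrt{\log n}}\right\rceil\, t(G).$$ Here $\log$ is the natural logarithm (the factor is at least as large, for every $n\ge 3$, when $\log$ is read to base $2$), and polynomial time means that some Turing machine computes $a$, with output in binary, in a number of steps bounded by a polynomial in the length of the input. -/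

import Mathlib

/-- `G` is a threshold graph: there are real vertex weights `w` and a real bound `s` such that two
distinct vertices are adjacent exactly when the sum of their weights is at least `s`. -/
def SimpleGraph.IsThreshold {V : Type*} (G : SimpleGraph V) : Prop :=
  ∃ (s : ℝ) (w : V → ℝ), ∀ u v : V, u ≠ v → (G.Adj u v ↔ s ≤ w u + w v)

/-- `E(G)` is covered by `k` threshold subgraphs of `G`, i.e. `E(G)` is the union of the edge sets
of `k` threshold graphs on the vertex set of `G`. -/
def SimpleGraph.HasThresholdCover {V : Type*} (G : SimpleGraph V) (k : ℕ) : Prop :=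
  ∃ T : Fin k → SimpleGraph V,
    (∀ i, (T i).IsThreshold) ∧ G.edgeSet = ⋃ i, (T i).edgeSet

/-- The threshold dimension `t(G)`: the least number of threshold subgraphs covering `E(G)`. -/
noncomputable def SimpleGraph.thresholdDim {V : Type*} (G : SimpleGraph V) : ℕ :=
  sInf {k : ℕ | G.HasThresholdCover k}

/-- A finite graph can be covered by threshold subgraphs (single edges), so that the minimum in
the definition of the threshold dimension is attained. -/
theorem SimpleGraph.hasThresholdCover_thresholdDim {V : Type*} [Finite V] (G : SimpleGraph V) :
    G.HasThresholdCover G.thresholdDim := by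
  classical
  have key : ∀ x ∈ G.edgeSet, (SimpleGraph.fromEdgeSet {x}).IsThreshold := by
    intro x hx
    induction x with
    | _ a b =>
      have hab : a ≠ b := G.ne_of_adj hx
      refine ⟨2, fun v => if v = a ∨ v = b then 1 else 0, fun u v huv => ?_⟩
      simp only [SimpleGraph.fromEdgeSet_adj, Set.mem_singleton_iff, Sym2.eq_iff]
      by_cases h1 : u = a <;> by_cases h2 : u = b <;> by_cases h3 : v = a <;>
        by_cases h4 : v = b <;> simp_all <;> norm_num
  refine Nat.sInf_mem (s := {k : ℕ | G.HasThresholdCover k}) ?_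
  obtain ⟨k, ⟨e⟩⟩ := Finite.exists_equiv_fin G.edgeSet
  refine ⟨k, fun i => SimpleGraph.fromEdgeSet {(e.symm i : Sym2 V)},
    fun i => key _ (e.symm i).2, ?_⟩
  · ext x
    simp only [Set.mem_iUnion, SimpleGraph.edgeSet_fromEdgeSet, Set.mem_sdiff,
      Set.mem_singleton_iff]
    constructor
    · intro hx
      exact ⟨e ⟨x, hx⟩, by simp, G.not_isDiag_of_mem_edgeSet hx⟩
    · rintro ⟨i, rfl, -⟩
      exact (e.symm i).2

/-- The instances of the problem: co-bipartite graphs (graphs whose complement is bipartite) with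
vertex set `{0, …, n - 1}`. -/
structure CoBipartiteGraph where
  /-- the number of vertices -/
  order : ℕ
  /-- the graph -/
  graph : SimpleGraph (Fin order)
  /-- its complement is bipartite -/
  compl_isBipartite : graphᶜ.IsBipartite

open Classical in
/-- The input word of an instance: its adjacency matrix, row by row, as a word over the alphabet
`{some true, some false, none}`, where `none` marks the end of a row. -/
noncomputable def CoBipartiteGraph.encode (G : CoBipartiteGraph) : List (Option Bool) :=
  (List.finRange G.order).flatMap fun i =>
    ((List.finRange G.order).map fun j => some (decide (G.graph.Adj i j))) ++ [none]

/-! Cut the vertices into blocks of `s` consecutive ones. Threshold subgraphs that cover the edges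
meeting each block together cover all edges, so the sum of their numbers bounds t(G) from above. For
a single block, a rank function on its vertices whose positive ranks span a clique yields a
threshold subgraph: the clique, with every other vertex joined to the ranks above its highest-ranked
non-neighbour (`IsCliqueRank.exists_isThreshold`). Several rank functions form a matrix with entries
at most `s`. There are (s+1)^(s^2) square ones, so if `s` is chosen to make this at most n^256, the
least number of rows can be found by exhaustive search in polynomial time. It is capped at `s`,
since the `s` stars at the block vertices always suffice.

For the quality, let `t` threshold graphs cover E(G). Since G is co-bipartite, its vertices split
into two cliques. Each threshold graph gives two rank functions, which order the block vertices in
either clique by weight. Replacing an endpoint of an edge by a vertex of larger weight keeps the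
edge, so these 2t rank functions cover the block (`exists_isBlockCover`). Hence a block costs at
most 2t. Unless s = n, maximality of `s` gives s^2 log log n ≥ log n (`le_mul_of_codeBound_lt`),
which bounds the number of nonempty blocks by the ceiling in the theorem.

For the running time, the algorithm is a term of a small arithmetic language whose only loops are
bounded sums and descending iterations. Values of terms, and hence the running times of the compiled
counter programs, are polynomially bounded (`Expr.exists_eval_le`, `Expr.exists_runsIn`). A stack
machine with unary counters simulates such programs step by step (`Run.exists_steps`). -/

/-! ### While programs on counters, an input tape and an output stack -/

/-- The memory of a counter program: natural-number registers, an input tape split at the head into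
the part already passed (reversed) and the part still ahead, and an output stack. -/
structure Store where
  /-- the registers -/
  regs : ℕ → ℕ
  /-- the part of the input tape ahead of the head -/
  ahead : List (Option Bool)
  /-- the part of the input tape behind the head, in reverse order -/
  behind : List (Option Bool)
  /-- the output stack -/
  out : List Bool

/-- Atomic actions of counter programs. -/
inductive Act
  | nop
  | inc (r : ℕ)
  | dec (r : ℕ)
  | advance
  | retreat
  | discard
  | scan (r : ℕ)
  | pushOut (b : Bool)
  | popOut

/-- Tests of counter programs. -/
inductive Test
  | pos (r : ℕ)
  | ahead
  | behind
  | outTrue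

/-- The effect of an action: `advance` and `retreat` move the head, `discard` deletes the symbol
ahead, `scan r` increments register `r` if the symbol ahead is `some true`. -/
def Act.apply : Act → Store → Store
  | nop, s => s
  | inc r, s => { s with regs := Function.update s.regs r (s.regs r + 1) }
  | dec r, s => { s with regs := Function.update s.regs r (s.regs r - 1) }
  | advance, s => { s with ahead := s.ahead.tail, behind := s.ahead.head?.toList ++ s.behind }
  | retreat, s => { s with behind := s.behind.tail, ahead := s.behind.head?.toList ++ s.ahead }
  | discard, s => { s with ahead := s.ahead.tail }
  | scan r, s =>
    if s.ahead.head? = some (some true) then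
      { s with regs := Function.update s.regs r (s.regs r + 1) } else s
  | pushOut b, s => { s with out := b :: s.out }
  | popOut, s => { s with out := s.out.tail }

/-- The outcome of a test. -/
def Test.holds : Test → Store → Bool
  | pos r, s => s.regs r ≠ 0
  | ahead, s => s.ahead ≠ []
  | behind, s => s.behind ≠ []
  | outTrue, s => s.out.head? = some true

/-- Counter programs. -/
inductive Prog
  | act (a : Act)
  | seq (p q : Prog)
  | whl (t : Test) (p : Prog)

/-- `Run p s t s'`: started in `s`, the program `p` stops in `s'` after at most `t` steps. -/
inductive Run : Prog → Store → ℕ → Store → Prop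
  | act (a : Act) (s : Store) : Run (.act a) s 1 (a.apply s)
  | seq {p q : Prog} {s s' s'' : Store} {t t' : ℕ} :
      Run p s t s' → Run q s' t' s'' → Run (.seq p q) s (t + t') s''
  | ended {b : Test} {p : Prog} {s : Store} : b.holds s = false → Run (.whl b p) s 1 s
  | loop {b : Test} {p : Prog} {s s' s'' : Store} {t t' : ℕ} : b.holds s = true →
      Run p s t s' → Run (.whl b p) s' t' s'' → Run (.whl b p) s (1 + t + t') s''
  | mono {p : Prog} {s₀ s₁ : Store} {t t' : ℕ} : Run p s₀ t s₁ → t ≤ t' → Run p s₀ t' s₁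

/-! ### Compilation of counter programs to stack machines -/

/-- The stacks of the machine of a program with `m` registers. -/
inductive Tape (m : ℕ)
  | ahead
  | behind
  | out
  | reg (r : Fin m)
  deriving DecidableEq, Fintype

/-- The stack alphabets. -/
abbrev Tape.Alphabet {m : ℕ} : Tape m → Type
  | ahead => Option Bool
  | behind => Option Bool
  | out => Bool
  | reg _ => Unit

/-- The stacks that represent a store. -/
def Store.stk {m : ℕ} (s : Store) : ∀ k : Tape m, List k.Alphabet
  | .ahead => s.ahead
  | .behind => s.behind
  | .out => s.out
  | .reg r => List.replicate (s.regs r) ()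

/-- Statements of the machine. The internal state is used only as a buffer for one symbol. -/
abbrev MStmt (m : ℕ) (Λ : Type) : Type :=
  Turing.TM2.Stmt (Tape.Alphabet (m := m)) Λ (Option (Option Bool))

/-- The registers of an action are among the first `m`. -/
def Act.Fits (m : ℕ) : Act → Prop
  | inc r | dec r | scan r => r < m
  | _ => True

/-- The registers of a test are among the first `m`. -/
def Test.Fits (m : ℕ) : Test → Prop
  | pos r => r < m
  | _ => True

/-- The registers of a program are among the first `m`. -/
def Prog.Fits (m : ℕ) : Prog → Prop
  | act a => a.Fits m
  | seq p q => p.Fits m ∧ q.Fits m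
  | whl t p => t.Fits m ∧ p.Fits m

theorem Act.exists_fits (a : Act) : ∃ m, ∀ m' ≥ m, a.Fits m' := by
  cases a with
  | inc r | dec r | scan r => exact ⟨r + 1, fun m' h => h⟩
  | _ => exact ⟨0, fun _ _ => trivial⟩

theorem Test.exists_fits (a : Test) : ∃ m, ∀ m' ≥ m, a.Fits m' := by
  cases a with
  | pos r => exact ⟨r + 1, fun m' h => h⟩
  | _ => exact ⟨0, fun _ _ => trivial⟩

theorem Prog.exists_fits (p : Prog) : ∃ m, ∀ m' ≥ m, p.Fits m' := by
  induction p with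
  | act a => exact a.exists_fits
  | seq p q hp hq =>
    obtain ⟨m, hm⟩ := hp
    obtain ⟨k, hk⟩ := hq
    exact ⟨max m k, fun m' h => ⟨hm _ (le_of_max_le_left h), hk _ (le_of_max_le_right h)⟩⟩
  | whl t p hp =>
    obtain ⟨m, hm⟩ := hp
    obtain ⟨k, hk⟩ := t.exists_fits
    exact ⟨max m k, fun m' h => ⟨hk _ (le_of_max_le_right h), hm _ (le_of_max_le_left h)⟩⟩

open Turing.TM2.Stmt in
/-- The statement that performs an action and goes to `e`. -/
def Act.code {m : ℕ} {Λ : Type} (e : Λ) : Act → MStmt m Λ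
  | nop => goto fun _ => e
  | inc r => if h : r < m then push (.reg ⟨r, h⟩) (fun _ => ()) (goto fun _ => e) else halt
  | dec r => if h : r < m then pop (.reg ⟨r, h⟩) (fun x _ => x) (goto fun _ => e) else halt
  | advance => pop .ahead (fun _ x => x) <| branch Option.isSome
      (push .behind (fun x => x.getD none) <| load (fun _ => none) <| goto fun _ => e)
      (goto fun _ => e)
  | retreat => pop .behind (fun _ x => x) <| branch Option.isSome
      (push .ahead (fun x => x.getD none) <| load (fun _ => none) <| goto fun _ => e)
      (goto fun _ => e)
  | discard => pop .ahead (fun x _ => x) (goto fun _ => e)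
  | scan r => if h : r < m then
      peek .ahead (fun _ x => x) <| branch (fun x => x = some (some true))
        (push (.reg ⟨r, h⟩) (fun _ => ()) <| load (fun _ => none) <| goto fun _ => e)
        (load (fun _ => none) <| goto fun _ => e) else halt
  | pushOut b => push .out (fun _ => b) (goto fun _ => e)
  | popOut => pop .out (fun x _ => x) (goto fun _ => e)

open Turing.TM2.Stmt in
/-- The statement that goes to `y` or `n` according to the outcome of a test. -/
def Test.code {m : ℕ} {Λ : Type} (y n : Λ) : Test → MStmt m Λ
  | pos r => if h : r < m then peek (.reg ⟨r, h⟩) (fun _ x => x.map fun _ => none) <|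
      branch Option.isSome (load (fun _ => none) <| goto fun _ => y) (goto fun _ => n) else halt
  | ahead => peek .ahead (fun _ x => x.map fun _ => none) <|
      branch Option.isSome (load (fun _ => none) <| goto fun _ => y) (goto fun _ => n)
  | behind => peek .behind (fun _ x => x.map fun _ => none) <|
      branch Option.isSome (load (fun _ => none) <| goto fun _ => y) (goto fun _ => n)
  | outTrue => peek .out (fun _ x => if x = some true then some none else none) <|
      branch Option.isSome (load (fun _ => none) <| goto fun _ => y) (goto fun _ => n)

/-- The whole action is one statement, hence one machine step. The buffer is empty before and after;
this invariant allows steps to be chained. -/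
theorem Act.stepAux_code {m : ℕ} {Λ : Type} (e : Λ) (a : Act) (ha : a.Fits m) (s : Store) :
    Turing.TM2.stepAux (a.code e : MStmt m Λ) none s.stk = ⟨some e, none, (a.apply s).stk⟩ := by
  have key : ∀ S S' : ∀ k : Tape m, List k.Alphabet, S .ahead = S' .ahead →
      S .behind = S' .behind → S .out = S' .out → (∀ r, S (.reg r) = S' (.reg r)) → S = S' := by
    intro S S' h1 h2 h3 h4
    funext k
    cases k <;> simp_all
  obtain ⟨regs, ah, be, out⟩ := s
  cases a with
  | nop => rfl
  | inc r =>
    replace ha : r < m := ha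
    simp only [code, ha, dite_true, Turing.TM2.stepAux, Turing.TM2.Cfg.mk.injEq, true_and]
    apply key <;> simp [Store.stk, apply, Function.update_apply, ← List.replicate_succ]
    rintro ⟨i, hi⟩
    obtain rfl | h := eq_or_ne i r <;> simp [Store.stk, List.replicate_succ, *]
  | dec r =>
    replace ha : r < m := ha
    simp only [code, ha, dite_true, Turing.TM2.stepAux, Turing.TM2.Cfg.mk.injEq, true_and]
    apply key <;> simp [Store.stk, apply, Function.update_apply]
    rintro ⟨i, hi⟩
    obtain rfl | h := eq_or_ne i r <;> simp [Store.stk, *]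
  | advance =>
    cases ah <;> simp [code, Store.stk, apply] <;>
      apply key <;> simp [Store.stk]
  | retreat =>
    cases be <;> simp [code, Store.stk, apply] <;>
      apply key <;> simp [Store.stk]
  | discard =>
    simp [code]
    apply key <;> simp [Store.stk, apply]
  | scan r =>
    replace ha : r < m := ha
    by_cases h : ah.head? = some (some true)
    · simp [code, ha, Store.stk, apply, h]
      apply key <;> simp [Store.stk, Function.update_apply]
      rintro ⟨i, hi⟩
      obtain rfl | h := eq_or_ne i r <;> simp [Store.stk, List.replicate_succ, *]
    · simp [code, ha, Store.stk, apply, h]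
  | pushOut b =>
    simp [code]
    apply key <;> simp [Store.stk, apply]
  | popOut =>
    simp [code]
    apply key <;> simp [Store.stk, apply]

theorem Test.stepAux_code {m : ℕ} {Λ : Type} (y n : Λ) (b : Test) (hb : b.Fits m) (s : Store) :
    Turing.TM2.stepAux (b.code y n : MStmt m Λ) none s.stk =
      ⟨some (if b.holds s then y else n), none, s.stk⟩ := by
  obtain ⟨regs, ah, be, out⟩ := s
  cases b with
  | pos r =>
    replace hb : r < m := hb
    rcases h : regs r <;> simp [code, hb, Store.stk, holds, h, List.replicate_succ]
  | ahead => cases ah <;> simp [code, Store.stk, holds]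
  | behind => cases be <;> simp [code, Store.stk, holds]
  | outTrue => by_cases h : out.head? = some true <;> simp [code, Store.stk, holds, h]

/-- The control positions inside a program. -/
def Prog.Pos : Prog → Type
  | act _ => Unit
  | seq p q => p.Pos ⊕ q.Pos
  | whl _ p => Option p.Pos

instance Prog.finite_pos (p : Prog) : Finite p.Pos := by
  induction p with
  | act a => exact inferInstanceAs (Finite Unit)
  | seq p q _ _ => exact inferInstanceAs (Finite (p.Pos ⊕ q.Pos))
  | whl t p _ => exact inferInstanceAs (Finite (Option p.Pos))

/-- The first control position of a program. -/
def Prog.entry : (p : Prog) → p.Pos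
  | act _ => ()
  | seq p _ => Sum.inl p.entry
  | whl _ _ => none

/-- The statement at a control position of a program whose positions are embedded in the labels by
`i` and that goes to `e` in the end. -/
def Prog.code {Λ : Type} (m : ℕ) : (p : Prog) → (p.Pos → Λ) → Λ → p.Pos → MStmt m Λ
  | act a, _, e, _ => a.code e
  | seq p q, i, _, .inl x => p.code m (i ∘ Sum.inl) (i (Sum.inr q.entry)) x
  | seq _ q, i, e, .inr x => q.code m (i ∘ Sum.inr) e x
  | whl t p, i, e, none => t.code (i (some p.entry)) e
  | whl _ p, i, _, some x => p.code m (i ∘ some) (i none) x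

/-- Induction on the run, concatenating machine paths. The freedom in `i` and `e` lets subprograms
live inside the same machine: the first half of a sequence exits to the entry of the second, and a
loop body exits to the test of its loop. -/
theorem Run.exists_steps {Λ : Type} {m : ℕ} (M : Λ → MStmt m Λ) {p : Prog} {s s' : Store} {t : ℕ}
    (h : Run p s t s') (hp : p.Fits m) (i : p.Pos → Λ) (e : Λ)
    (hM : ∀ x, M (i x) = p.code m i e x) :
    ∃ k ≤ t, (flip bind (Turing.TM2.step M))^[k] (some ⟨some (i p.entry), none, s.stk⟩) =
      some ⟨some e, none, s'.stk⟩ := by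
  induction h generalizing e with
  | act a s =>
    refine ⟨1, le_rfl, ?_⟩
    have := hM ()
    simp only [Prog.code] at this
    simp only [Function.iterate_one, flip, Option.bind_eq_bind, Option.bind_some,
      Turing.TM2.step]
    erw [this, Act.stepAux_code e a hp s]
  | @seq p q s s' s'' t t' _ _ h₁ h₂ =>
    obtain ⟨k, hk, h₁⟩ := h₁ hp.1 (i ∘ Sum.inl) (i (Sum.inr q.entry)) fun x => hM (Sum.inl x)
    obtain ⟨k', hk', h₂⟩ := h₂ hp.2 (i ∘ Sum.inr) e fun x => hM (Sum.inr x)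
    refine ⟨k' + k, by omega, ?_⟩
    rw [Function.iterate_add_apply]
    exact (congrArg _ h₁).trans h₂
  | @ended b p s hb =>
    refine ⟨1, le_rfl, ?_⟩
    have := hM none
    simp only [Prog.code] at this
    simp only [Function.iterate_one, flip, Option.bind_eq_bind, Option.bind_some,
      Turing.TM2.step]
    erw [this, Test.stepAux_code _ _ b hp.1 s]
    simp [hb]
  | @loop b p s s' s'' t t' hb _ _ h₁ h₂ =>
    obtain ⟨k, hk, h₁⟩ := h₁ hp.2 (i ∘ some) (i none) fun x => hM (some x)
    obtain ⟨k', hk', h₂⟩ := h₂ hp i e hM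
    refine ⟨k' + (k + 1), by omega, ?_⟩
    rw [Function.iterate_add_apply, Function.iterate_add_apply]
    have h₀ : (flip bind (Turing.TM2.step M))^[1]
        (some ⟨some (i (Prog.whl b p).entry), none, s.stk⟩) =
        some ⟨some (i (some p.entry)), none, s.stk⟩ := by
      have := hM none
      simp only [Prog.code] at this
      simp only [Function.iterate_one, flip, Option.bind_eq_bind, Option.bind_some,
        Turing.TM2.step]
      erw [this, Test.stepAux_code _ _ b hp.1 s]
      simp [hb]
    rw [h₀]
    exact (congrArg _ h₁).trans h₂
  | mono _ ht h =>
    obtain ⟨k, hk, h⟩ := h hp i e hM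
    exact ⟨k, hk.trans ht, h⟩

open Classical in
/-- The machine of a program with registers among the first `m`. -/
noncomputable def Prog.machine (m : ℕ) (p : Prog) : Turing.FinTM2 where
  K := Tape m
  k₀ := .ahead
  k₁ := .out
  Γ := Tape.Alphabet
  Λ := Option p.Pos
  main := some p.entry
  ΛFin := Fintype.ofFinite _
  σ := Option (Option Bool)
  initialState := none
  m
    | none => Turing.TM2.Stmt.halt
    | some x => p.code m some none x

/-- A program that turns every input word into the right output word within polynomial time yields
a polynomial-time machine. -/
theorem Prog.computable {α : Type} (ea : α → List (Option Bool)) (eb : ℕ → List Bool) (f : α → ℕ)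
    (p : Prog) (T : Polynomial ℕ)
    (h : ∀ a, Run p ⟨fun _ => 0, ea a, [], []⟩ (T.eval (ea a).length)
      ⟨fun _ => 0, [], [], eb (f a)⟩) :
    Nonempty (Turing.TM2ComputableInPolyTime ea eb f) := by
  obtain ⟨m, hm⟩ := p.exists_fits
  refine ⟨{
    tm := p.machine m
    inputAlphabet := Equiv.refl _
    outputAlphabet := Equiv.refl _
    -- The additional step executes `halt` at the exit label `none`.
    time := T + 1
    outputsFun := fun a => Classical.choice ?_ }⟩
  obtain ⟨k, hk, hs⟩ := (h a).exists_steps (p.machine m).m (hm m le_rfl) some none fun x => rfl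
  refine ⟨⟨⟨k + 1, ?_⟩, by simpa using hk⟩⟩
  rw [add_comm, Function.iterate_add_apply]
  have hinit : Turing.initList (p.machine m) (List.map (Equiv.refl (Option Bool)).invFun (ea a)) =
      ⟨some (some p.entry), none, Store.stk ⟨fun _ => 0, ea a, [], []⟩⟩ := by
    unfold Turing.initList
    congr 1
    funext k
    cases k <;> simp [Prog.machine, Store.stk] <;> rfl
  have hhalt : Turing.haltList (p.machine m) (List.map (Equiv.refl Bool).invFun (eb (f a))) =
      ⟨none, none, Store.stk ⟨fun _ => 0, [], [], eb (f a)⟩⟩ := by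
    unfold Turing.haltList
    congr 1
    funext k
    cases k <;> simp [Prog.machine, Store.stk] <;> rfl
  refine (congrArg _ ((congrArg _ (congrArg some hinit)).trans hs)).trans ?_
  refine Eq.trans ?_ (congrArg some hhalt).symm
  rfl

/-! ### A language of polynomially bounded arithmetic -/

/-- Terms over a list of variables and an input word. -/
inductive Expr
  | one
  | var (i : ℕ)
  | add (a b : Expr)
  | bit (a : Expr)
  | sum (c b : Expr)
  | desc (c a b : Expr)
  | bind (a f : Expr)
  | take (k : ℕ) (f : Expr)
  | drop (k : ℕ) (f : Expr)

/-- The value of a term: `bit a` tells whether the symbol at position `a` of the input word is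
`some true`, `sum c b` is the sum of `b` over all values below `c` of a new variable, `desc c a b`
starts from `a` and subtracts `c` times the value of `b` at the current value, `bind a f` is `f`
with `a` as the value of a new variable, `take` and `drop` restrict the list of variables. -/
def Expr.eval (w : List (Option Bool)) : Expr → List ℕ → ℕ
  | one, _ => 1
  | var i, l => l.getD i 0
  | add a b, l => a.eval w l + b.eval w l
  | bit a, l => if w[a.eval w l]? = some (some true) then 1 else 0
  | sum c b, l => ∑ i ∈ Finset.range (c.eval w l), b.eval w (i :: l)
  | desc c a b, l => (fun x => x - b.eval w (x :: l))^[c.eval w l] (a.eval w l)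
  | bind a f, l => f.eval w (a.eval w l :: l)
  | take k f, l => f.eval w (l.take k)
  | drop k f, l => f.eval w (l.drop k)

theorem Nat.iterate_sub_le (g : ℕ → ℕ) (c x : ℕ) : (fun x => x - g x)^[c] x ≤ x := by
  induction c with
  | zero => rfl
  | succ c ih =>
    rw [Function.iterate_succ_apply']
    exact (Nat.sub_le _ _).trans ih

/-- The bound is uniform in the word, which enters only through the truth values of `bit`. A
summation variable stays below the value of the range, so the body is bounded at `C + X`. A
descending iteration never exceeds its initial value, however many passes it makes. -/
theorem Expr.exists_eval_le (e : Expr) : ∃ V : Polynomial ℕ, ∀ (w : List (Option Bool))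
    (l : List ℕ) (M : ℕ), (∀ x ∈ l, x ≤ M) → e.eval w l ≤ V.eval M := by
  induction e with
  | one => exact ⟨1, fun w l M _ => by simp [eval]⟩
  | var i =>
    refine ⟨.X, fun w l M h => ?_⟩
    simp only [eval, Polynomial.eval_X, List.getD_eq_getElem?_getD]
    rcases hi : l[i]? with _ | x
    · simp
    · simpa using h x (List.mem_of_getElem? hi)
  | add a b ha hb =>
    obtain ⟨A, hA⟩ := ha
    obtain ⟨B, hB⟩ := hb
    exact ⟨A + B, fun w l M h => by
      simpa [eval] using add_le_add (hA w l M h) (hB w l M h)⟩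
  | bit a _ => exact ⟨1, fun w l M _ => by simp only [eval]; split_ifs <;> simp⟩
  | sum c b hc hb =>
    obtain ⟨C, hC⟩ := hc
    obtain ⟨B, hB⟩ := hb
    refine ⟨C * B.comp (C + .X), fun w l M h => ?_⟩
    simp only [eval, Polynomial.eval_mul, Polynomial.eval_comp, Polynomial.eval_add,
      Polynomial.eval_X]
    refine (Finset.sum_le_card_nsmul _ _ (B.eval (C.eval M + M)) fun i hi => ?_).trans ?_
    · refine hB w _ _ fun x hx => ?_
      have := hC w l M h
      rcases List.mem_cons.1 hx with rfl | hx
      · have := Finset.mem_range.1 hi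
        omega
      · have := h x hx
        omega
    · simpa using Nat.mul_le_mul_right _ (hC w l M h)
  | desc c a b _ ha _ =>
    obtain ⟨A, hA⟩ := ha
    exact ⟨A, fun w l M h => (Nat.iterate_sub_le _ _ _).trans (hA w l M h)⟩
  | bind a f ha hf =>
    obtain ⟨A, hA⟩ := ha
    obtain ⟨F, hF⟩ := hf
    refine ⟨F.comp (A + .X), fun w l M h => ?_⟩
    simp only [eval, Polynomial.eval_comp, Polynomial.eval_add, Polynomial.eval_X]
    refine hF w _ _ fun x hx => ?_
    have := hA w l M h
    rcases List.mem_cons.1 hx with rfl | hx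
    · omega
    · have := h x hx
      omega
  | take k f hf =>
    obtain ⟨F, hF⟩ := hf
    exact ⟨F, fun w l M h => hF w _ M fun x hx => h x (List.mem_of_mem_take hx)⟩
  | drop k f hf =>
    obtain ⟨F, hF⟩ := hf
    exact ⟨F, fun w l M h => hF w _ M fun x hx => h x (List.mem_of_mem_drop hx)⟩

/-! ### Compilation of terms to counter programs -/

namespace Prog

/-- Add register `a` to register `b` and clear register `a`. -/
def move (a b : ℕ) : Prog := whl (.pos a) (seq (act (.dec a)) (act (.inc b)))

end Prog

open Prog

/-- The program that adds the value of a term to register `d`, where the variables are held by the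
registers `ρ` below `d`, and the registers above `d` serve as scratch memory. -/
def Expr.compile : Expr → List ℕ → ℕ → Prog
  | one, _, d => act (.inc d)
  | var i, ρ, d => match ρ[i]? with
    | none => act .nop
    | some r => seq (whl (.pos r) (seq (act (.dec r)) (seq (act (.inc d)) (act (.inc (d + 1))))))
        (move (d + 1) r)
  | add a b, ρ, d => seq (a.compile ρ d) (b.compile ρ d)
  | bit a, ρ, d => seq (a.compile ρ (d + 1))
      (seq (whl (.pos (d + 1)) (seq (act (.dec (d + 1))) (act .advance)))
      (seq (act (.scan d)) (whl .behind (act .retreat))))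
  | sum c b, ρ, d => seq (c.compile ρ (d + 1))
      (seq (whl (.pos (d + 1)) (seq (act (.dec (d + 1))) (seq (b.compile ((d + 2) :: ρ) (d + 3))
        (seq (move (d + 3) d) (act (.inc (d + 2)))))))
      (whl (.pos (d + 2)) (act (.dec (d + 2)))))
  | desc c a b, ρ, d => seq (c.compile ρ (d + 1)) (seq (a.compile ρ (d + 2))
      (seq (whl (.pos (d + 1)) (seq (act (.dec (d + 1))) (seq (b.compile ((d + 2) :: ρ) (d + 3))
        (whl (.pos (d + 3)) (seq (act (.dec (d + 3))) (act (.dec (d + 2))))))))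
      (move (d + 2) d)))
  | bind a f, ρ, d => seq (a.compile ρ (d + 1)) (seq (f.compile ((d + 1) :: ρ) (d + 2))
      (seq (whl (.pos (d + 1)) (act (.dec (d + 1)))) (move (d + 2) d)))
  | take k f, ρ, d => f.compile (ρ.take k) d
  | drop k f, ρ, d => f.compile (ρ.drop k) d

/-! ### Correctness and running time of the compiled programs -/

theorem Run.cast {p : Prog} {s₀ s s' s'' : Store} {t t' : ℕ} (h : Run p s₀ t s') (hs₀ : s₀ = s)
    (hs : s' = s'') (ht : t ≤ t') : Run p s t' s'' :=
  hs₀ ▸ hs ▸ h.mono ht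

theorem Store.mk_congr {r r' : ℕ → ℕ} {u v : List (Option Bool)} {o : List Bool}
    (h : ∀ j, r j = r' j) : Store.mk r u v o = ⟨r', u, v, o⟩ := by
  rw [funext h]

/-- The loop rule: `S i` is the store after `i` passes. Each pass costs one more step for its test,
and the failing test costs the last one. -/
theorem Prog.run_whl_iterate {b : Test} {p : Prog} (t c : ℕ) (S : ℕ → Store)
    (h : ∀ i < c, b.holds (S i) = true ∧ Run p (S i) t (S (i + 1)))
    (hc : b.holds (S c) = false) : Run (.whl b p) (S 0) (c * (t + 1) + 1) (S c) := by
  induction c generalizing S with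
  | zero => simpa using Run.ended hc
  | succ c ih =>
    refine (Run.loop (h 0 (by omega)).1 (h 0 (by omega)).2
      (ih (fun i => S (i + 1)) (fun i hi => h (i + 1) (by omega)) hc)).mono ?_
    rw [Nat.succ_mul]
    omega

open Function in
theorem Prog.run_move {a b : ℕ} (hab : a ≠ b) (r : ℕ → ℕ) (u v : List (Option Bool))
    (o : List Bool) :
    Run (Prog.move a b) ⟨r, u, v, o⟩ (3 * r a + 1)
      ⟨update (update r a 0) b (r b + r a), u, v, o⟩ := by
  refine (Prog.run_whl_iterate (b := .pos a) (p := seq (act (.dec a)) (act (.inc b))) 2 (r a)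
    (fun i => ⟨update (update r a (r a - i)) b (r b + i), u, v, o⟩) ?_ ?_).cast
    (Store.mk_congr fun j => ?_) (Store.mk_congr fun j => ?_) (by omega)
  · intro i hi
    refine ⟨by simp [Test.holds, hab]; omega, ?_⟩
    refine (Run.seq (.act _ _) (.act _ _)).cast rfl (Store.mk_congr fun j => ?_) le_rfl
    simp only [Act.apply, update_apply]
    grind
  · simp [Test.holds, hab]
  all_goals
    simp only [update_apply]
    grind

open Function in
theorem Prog.run_clear (a : ℕ) (r : ℕ → ℕ) (u v : List (Option Bool)) (o : List Bool) :
    Run (whl (.pos a) (act (.dec a))) ⟨r, u, v, o⟩ (2 * r a + 1)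
      ⟨update r a 0, u, v, o⟩ := by
  refine (Prog.run_whl_iterate (b := .pos a) (p := act (.dec a)) 1 (r a)
    (fun i => ⟨update r a (r a - i), u, v, o⟩) ?_ ?_).cast
    (Store.mk_congr fun j => ?_) (Store.mk_congr fun j => ?_) (by omega)
  · intro i hi
    refine ⟨by simp [Test.holds]; omega, ?_⟩
    refine (Run.act _ _).cast rfl (Store.mk_congr fun j => ?_) le_rfl
    simp only [update_apply]
    grind
  · simp [Test.holds]
  all_goals
    simp only [update_apply]
    grind

open Function in
theorem Prog.run_subtract {a b : ℕ} (hab : a ≠ b) (r : ℕ → ℕ) (u v : List (Option Bool))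
    (o : List Bool) :
    Run (whl (.pos a) (seq (act (.dec a)) (act (.dec b)))) ⟨r, u, v, o⟩ (3 * r a + 1)
      ⟨update (update r a 0) b (r b - r a), u, v, o⟩ := by
  refine (Prog.run_whl_iterate (b := .pos a) (p := seq (act (.dec a)) (act (.dec b))) 2 (r a)
    (fun i => ⟨update (update r a (r a - i)) b (r b - i), u, v, o⟩) ?_ ?_).cast
    (Store.mk_congr fun j => ?_) (Store.mk_congr fun j => ?_) (by omega)
  · intro i hi
    refine ⟨by simp [Test.holds, hab]; omega, ?_⟩
    refine (Run.seq (.act _ _) (.act _ _)).cast rfl (Store.mk_congr fun j => ?_) le_rfl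
    simp only [Act.apply, update_apply]
    grind
  · simp [Test.holds, hab]
  all_goals
    simp only [update_apply]
    grind

-- Emptying a register is the only way to read its value, so the content goes to `d` and `d + 1` at
-- once and is then restored from `d + 1`.
open Function in
theorem Prog.run_copy {a d : ℕ} (had : a < d) (r : ℕ → ℕ) (hr : r (d + 1) = 0)
    (u v : List (Option Bool)) (o : List Bool) :
    Run (seq (whl (.pos a) (seq (act (.dec a)) (seq (act (.inc d)) (act (.inc (d + 1))))))
        (Prog.move (d + 1) a))
      ⟨r, u, v, o⟩ (7 * r a + 2) ⟨update r d (r d + r a), u, v, o⟩ := by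
  have := Prog.run_whl_iterate (b := .pos a)
    (p := seq (act (.dec a)) (seq (act (.inc d)) (act (.inc (d + 1))))) 3 (r a)
    (fun i => ⟨update (update (update r a (r a - i)) d (r d + i)) (d + 1) i, u, v, o⟩) ?_ ?_
  · refine (this.seq (Prog.run_move (a := d + 1) (b := a) (by omega) _ _ _ _)).cast
      (Store.mk_congr fun j => ?_) (Store.mk_congr fun j => ?_) (by simp; omega)
    all_goals
      simp only [update_apply]
      grind
  · intro i hi
    refine ⟨by simp [Test.holds, update_apply]; grind, ?_⟩
    refine (Run.seq (.act _ _) (Run.seq (.act _ _) (.act _ _))).cast rfl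
      (Store.mk_congr fun j => ?_) le_rfl
    simp only [Act.apply, update_apply]
    grind
  · simp [Test.holds, update_apply]
    grind

theorem Prog.run_rewind (r : ℕ → ℕ) (u v : List (Option Bool)) (o : List Bool) :
    Run (whl .behind (act .retreat)) ⟨r, u, v, o⟩ (2 * v.length + 1)
      ⟨r, v.reverse ++ u, [], o⟩ := by
  induction v generalizing u with
  | nil => exact .ended rfl
  | cons x v ih =>
    refine (Run.loop rfl (.act _ _) (ih (x :: u))).cast rfl (by simp) ?_
    simp only [List.length_cons]
    omega

-- `k` may exceed the length of the word: at the end of the tape `advance` does nothing, in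
-- agreement with `drop` and `take`.
open Function in
theorem Prog.run_advance (a k : ℕ) (r : ℕ → ℕ) (hr : r a = k) (u : List (Option Bool))
    (o : List Bool) :
    Run (whl (.pos a) (seq (act (.dec a)) (act .advance))) ⟨r, u, [], o⟩ (3 * k + 1)
      ⟨update r a 0, u.drop k, (u.take k).reverse, o⟩ := by
  refine (Prog.run_whl_iterate (b := .pos a) (p := seq (act (.dec a)) (act .advance)) 2 k
    (fun i => ⟨update r a (k - i), u.drop i, (u.take i).reverse, o⟩) ?_ ?_).cast
    (Store.mk_congr fun j => ?_) (Store.mk_congr fun j => ?_) (by omega)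
  · intro i hi
    refine ⟨by simp [Test.holds]; omega, ?_⟩
    refine (Run.seq (.act _ _) (.act _ _)).cast rfl ?_ le_rfl
    simp only [Act.apply, Store.mk.injEq, and_true]
    refine ⟨?_, by simp, ?_⟩
    · funext j
      simp only [update_apply]
      grind
    · rcases lt_or_ge i u.length with h | h
      · rw [List.take_add_one, List.reverse_append]
        simp [h]
      · simp [List.take_of_length_le, h, h.trans (Nat.le_succ i)]
  · simp [Test.holds]
  all_goals
    simp only [update_apply]
    grind

/-- `e.RunsIn T`: the program of the term `e` is correct and stops within `T M` steps if the
variables have values at most `M`. -/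
def Expr.RunsIn (e : Expr) (T : Polynomial ℕ) : Prop :=
  ∀ (ρ l : List ℕ) (d M : ℕ) (r r' : ℕ → ℕ) (w : List (Option Bool)) (o : List Bool),
    (∀ i ∈ ρ, i < d) → ρ.map r = l → (∀ x ∈ l, x ≤ M) → (∀ j > d, r j = 0) →
    (∀ j, r' j = if j = d then r d + e.eval w l else r j) →
    Run (e.compile ρ d) ⟨r, w, [], o⟩ (T.eval M) ⟨r', w, [], o⟩

theorem List.map_eq_of_eqOn_lt {ρ l : List ℕ} {r r' : ℕ → ℕ} {d : ℕ} (h : ρ.map r = l)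
    (hρ : ∀ i ∈ ρ, i < d) (h' : ∀ i < d, r' i = r i) : ρ.map r' = l :=
  h ▸ List.map_congr_left fun i hi => h' i (hρ i hi)

namespace Expr

open Function

theorem runsIn_one : one.RunsIn 1 := by
  intro ρ l d M r r' w o hρ hl hM hr hr'
  refine (Run.act _ _).cast rfl (Store.mk_congr fun j => ?_) (by simp)
  simp only [update_apply, hr', eval]

theorem runsIn_var (i : ℕ) : (var i).RunsIn (7 * .X + 2) := by
  intro ρ l d M r r' w o hρ hl hM hr hr'
  subst hl
  rcases hi : ρ[i]? with _ | a
  · simp only [compile, hi]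
    refine (Run.act _ _).cast rfl (Store.mk_congr fun j => ?_) (by simp)
    simp [hi, hr', eval]
    grind
  · simp only [compile, hi]
    have ha := List.mem_of_getElem? hi
    refine (run_copy (hρ a ha) r (hr _ (by omega)) w [] o).cast rfl
      (Store.mk_congr fun j => ?_) ?_
    · simp [hi, hr', eval, update_apply]
    · simpa using hM (r a) (List.mem_map_of_mem ha)

theorem RunsIn.add {a b : Expr} {A B : Polynomial ℕ} (hA : a.RunsIn A) (hB : b.RunsIn B) :
    (add a b).RunsIn (A + B) := by
  intro ρ l d M r r' w o hρ hl hM hr hr'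
  have h₁ := hA ρ l d M r (fun j => if j = d then r d + a.eval w l else r j) w o hρ hl hM hr
    fun j => rfl
  refine (h₁.seq (hB ρ l d M _ r' w o hρ (List.map_eq_of_eqOn_lt hl hρ fun i hi => ?_) hM ?_
    ?_)).mono (by simp)
  all_goals grind [eval]

/-- Going to the position and rewinding both cost time linear in the position, not in the length of
the word, so a bound in terms of `M` alone is possible. -/
theorem RunsIn.bit {a : Expr} {A V : Polynomial ℕ} (hA : a.RunsIn A)
    (hV : ∀ w l M, (∀ x ∈ l, x ≤ M) → a.eval w l ≤ V.eval M) :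
    (bit a).RunsIn (A + (5 * V + 3)) := by
  intro ρ l d M r r' w o hρ hl hM hr hr'
  have hv := hV w l M hM
  obtain ⟨v, hv'⟩ : ∃ v, v = a.eval w l := ⟨_, rfl⟩
  rw [← hv'] at hv
  have h₁ := hA ρ l (d + 1) M r (fun j => if j = d + 1 then v else r j) w o (by grind) hl hM
    (by grind) (by grind)
  have h₂ := (run_advance (d + 1) v (fun j => if j = d + 1 then v else r j) (by grind) w o).cast
    (s'' := ⟨r, w.drop v, (w.take v).reverse, o⟩) rfl
    (Store.mk_congr fun j => by simp only [update_apply]; grind) le_rfl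
  have h₃ := (Run.act (.scan d) ⟨r, w.drop v, (w.take v).reverse, o⟩).cast
    (s'' := ⟨r', w.drop v, (w.take v).reverse, o⟩) rfl (by
      simp only [Act.apply, List.head?_drop]
      split_ifs with h
      · exact Store.mk_congr fun j => by simp [hr', eval, ← hv', h, update_apply]
      · exact Store.mk_congr fun j => by simp +contextual [hr', eval, ← hv', h]) le_rfl
  have h₄ := (run_rewind r' (w.drop v) (w.take v).reverse o).cast
    (s'' := ⟨r', w, [], o⟩) (t' := 2 * v + 1) rfl (by simp) (by simp)
  refine (h₁.seq (h₂.seq (h₃.seq h₄))).mono ?_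
  simp
  omega

theorem RunsIn.sum {c b : Expr} {C B VC VB : Polynomial ℕ} (hC : c.RunsIn C) (hB : b.RunsIn B)
    (hVC : ∀ w l M, (∀ x ∈ l, x ≤ M) → c.eval w l ≤ VC.eval M)
    (hVB : ∀ w l M, (∀ x ∈ l, x ≤ M) → b.eval w l ≤ VB.eval M) :
    (sum c b).RunsIn (C + ((VC * (B.comp (VC + .X) + 3 * VB.comp (VC + .X) + 4) + 1) +
      (2 * VC + 1))) := by
  intro ρ l d M r r' w o hρ hl hM hr hr'
  have hv := hVC w l M hM
  obtain ⟨v, hv'⟩ : ∃ v, v = c.eval w l := ⟨_, rfl⟩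
  rw [← hv'] at hv
  obtain ⟨g, hg⟩ : ∃ g : ℕ → ℕ, g = fun i => b.eval w (i :: l) := ⟨_, rfl⟩
  obtain ⟨G, hG⟩ : ∃ G : ℕ → ℕ, G = fun i => ∑ j ∈ Finset.range i, g j := ⟨_, rfl⟩
  have hG0 : G 0 = 0 := by simp [hG]
  have hG1 : ∀ i, G (i + 1) = G i + g i := fun i => by simp [hG, Finset.sum_range_succ]
  have hGv : eval w (Expr.sum c b) l = G v := by simp [eval, hG, hg, hv']
  have hM' : ∀ i < v, ∀ x ∈ i :: l, x ≤ VC.eval M + M := by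
    intro i hi x hx
    rcases List.mem_cons.1 hx with rfl | hx
    · omega
    · have := hM x hx
      omega
  have hgi : ∀ i < v, g i ≤ VB.eval (VC.eval M + M) := fun i hi => hg ▸ hVB w _ _ (hM' i hi)
  -- Registers after `i` passes: `d` holds the partial sum, `d + 1` the number of passes left, `d +
  -- 2` the summation variable.
  let R : ℕ → ℕ → ℕ := fun i j =>
    if j = d then r d + G i else if j = d + 1 then v - i else if j = d + 2 then i else r j
  have h₁ := hC ρ l (d + 1) M r (R 0) w o (by grind) hl hM (by grind) (by grind)
  have h₂ := run_whl_iterate (b := .pos (d + 1)) (p := seq (act (.dec (d + 1)))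
    (seq (b.compile ((d + 2) :: ρ) (d + 3)) (seq (Prog.move (d + 3) d) (act (.inc (d + 2))))))
    (B.eval (VC.eval M + M) + 3 * VB.eval (VC.eval M + M) + 3) v (fun i => ⟨R i, w, [], o⟩) ?_ ?_
  · have h₃ := (run_clear (d + 2) (R v) w [] o).cast (s'' := ⟨r', w, [], o⟩) rfl
      (Store.mk_congr fun j => by simp only [update_apply]; grind) le_rfl
    refine (h₁.seq (h₂.seq h₃)).mono ?_
    have hR : R v (d + 2) = v := by grind
    simp only [hR, Polynomial.eval_add, Polynomial.eval_mul, Polynomial.eval_comp,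
      Polynomial.eval_X, Polynomial.eval_one, Polynomial.eval_ofNat]
    linarith [Nat.mul_le_mul_right
      (B.eval (VC.eval M + M) + 3 * VB.eval (VC.eval M + M) + 3 + 1) hv]
  · intro i hi
    refine ⟨by simp [Test.holds]; grind, ?_⟩
    have b₁ := (Run.act (.dec (d + 1)) ⟨R i, w, [], o⟩).cast
      (s'' := ⟨fun j => if j = d + 1 then v - (i + 1) else R i j, w, [], o⟩) rfl
      (Store.mk_congr fun j => by simp only [update_apply]; grind) le_rfl
    have b₂ := hB ((d + 2) :: ρ) (i :: l) (d + 3) _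
      (fun j => if j = d + 1 then v - (i + 1) else R i j)
      (fun j => if j = d + 1 then v - (i + 1) else if j = d + 3 then g i else R i j) w o (by grind)
      (by
        rw [List.map_cons, List.map_eq_of_eqOn_lt hl hρ (by grind)]
        grind) (hM' i hi) (by grind) (by grind)
    have b₃ := (run_move (a := d + 3) (b := d) (by omega)
      (fun j => if j = d + 1 then v - (i + 1) else if j = d + 3 then g i else R i j)
      w [] o).cast (s'' := ⟨fun j => if j = d + 2 then i else R (i + 1) j, w, [], o⟩) rfl
      (Store.mk_congr fun j => by simp only [update_apply]; grind) le_rfl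
    have b₄ := (Run.act (.inc (d + 2)) ⟨fun j => if j = d + 2 then i else R (i + 1) j, w, [], o⟩)
      |>.cast (s'' := ⟨R (i + 1), w, [], o⟩) rfl
      (Store.mk_congr fun j => by simp only [update_apply]; grind) le_rfl
    refine (b₁.seq (b₂.seq (b₃.seq b₄))).mono ?_
    have := hgi i hi
    simp
    omega
  · simp [Test.holds]
    grind

theorem RunsIn.desc {c a b : Expr} {C A B VC VA VB : Polynomial ℕ} (hC : c.RunsIn C)
    (hA : a.RunsIn A) (hB : b.RunsIn B)
    (hVC : ∀ w l M, (∀ x ∈ l, x ≤ M) → c.eval w l ≤ VC.eval M)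
    (hVA : ∀ w l M, (∀ x ∈ l, x ≤ M) → a.eval w l ≤ VA.eval M)
    (hVB : ∀ w l M, (∀ x ∈ l, x ≤ M) → b.eval w l ≤ VB.eval M) :
    (desc c a b).RunsIn (C + (A + ((VC * (B.comp (VA + .X) + 3 * VB.comp (VA + .X) + 3) + 1) +
      (3 * VA + 1)))) := by
  intro ρ l d M r r' w o hρ hl hM hr hr'
  have hv := hVC w l M hM
  have hx := hVA w l M hM
  obtain ⟨v, hv'⟩ : ∃ v, v = c.eval w l := ⟨_, rfl⟩
  rw [← hv'] at hv
  obtain ⟨g, hg⟩ : ∃ g : ℕ → ℕ, g = fun i => b.eval w (i :: l) := ⟨_, rfl⟩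
  obtain ⟨G, hG⟩ : ∃ G : ℕ → ℕ, G = fun i => (fun x => x - g x)^[i] (a.eval w l) := ⟨_, rfl⟩
  have hG0 : G 0 = a.eval w l := by simp [hG]
  have hG1 : ∀ i, G (i + 1) = G i - g (G i) := fun i => by
    simp only [hG, Function.iterate_succ_apply']
  have hGv : eval w (Expr.desc c a b) l = G v := by simp [eval, hG, hg, hv']
  have hGx : ∀ i, G i ≤ VA.eval M := fun i => hG ▸ (Nat.iterate_sub_le _ _ _).trans hx
  have hM' : ∀ i, ∀ x ∈ G i :: l, x ≤ VA.eval M + M := by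
    intro i x hx
    rcases List.mem_cons.1 hx with rfl | hx
    · have := hGx i
      omega
    · have := hM x hx
      omega
  have hgi : ∀ i, g (G i) ≤ VB.eval (VA.eval M + M) := fun i => hg ▸ hVB w _ _ (hM' i)
  -- The current value in `d + 2` is itself the variable of the body.
  let R : ℕ → ℕ → ℕ := fun i j => if j = d + 1 then v - i else if j = d + 2 then G i else r j
  have h₁ := hC ρ l (d + 1) M r (fun j => if j = d + 1 then v else r j) w o (by grind) hl hM
    (by grind) (by grind)
  have h₁' := hA ρ l (d + 2) M (fun j => if j = d + 1 then v else r j) (R 0) w o (by grind)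
    (List.map_eq_of_eqOn_lt hl hρ (by grind)) hM (by grind) (by grind)
  have h₂ := run_whl_iterate (b := .pos (d + 1)) (p := seq (act (.dec (d + 1)))
    (seq (b.compile ((d + 2) :: ρ) (d + 3)) (whl (.pos (d + 3)) (seq (act (.dec (d + 3)))
      (act (.dec (d + 2)))))))
    (B.eval (VA.eval M + M) + 3 * VB.eval (VA.eval M + M) + 2) v (fun i => ⟨R i, w, [], o⟩) ?_ ?_
  · have h₃ := (run_move (a := d + 2) (b := d) (by omega) (R v) w [] o).cast
      (s'' := ⟨r', w, [], o⟩) rfl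
      (Store.mk_congr fun j => by simp only [update_apply]; grind) le_rfl
    refine (h₁.seq (h₁'.seq (h₂.seq h₃))).mono ?_
    have hR : R v (d + 2) = G v := by grind
    have := hGx v
    simp only [hR, Polynomial.eval_add, Polynomial.eval_mul, Polynomial.eval_comp,
      Polynomial.eval_X, Polynomial.eval_one, Polynomial.eval_ofNat]
    linarith [Nat.mul_le_mul_right
      (B.eval (VA.eval M + M) + 3 * VB.eval (VA.eval M + M) + 2 + 1) hv]
  · intro i hi
    refine ⟨by simp [Test.holds]; grind, ?_⟩
    have b₁ := (Run.act (.dec (d + 1)) ⟨R i, w, [], o⟩).cast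
      (s'' := ⟨fun j => if j = d + 1 then v - (i + 1) else R i j, w, [], o⟩) rfl
      (Store.mk_congr fun j => by simp only [update_apply]; grind) le_rfl
    have b₂ := hB ((d + 2) :: ρ) (G i :: l) (d + 3) _
      (fun j => if j = d + 1 then v - (i + 1) else R i j)
      (fun j => if j = d + 1 then v - (i + 1) else if j = d + 3 then g (G i) else R i j) w o
      (by grind)
      (by
        rw [List.map_cons, List.map_eq_of_eqOn_lt hl hρ (by grind)]
        grind) (hM' i) (by grind) (by grind)
    have b₃ := (run_subtract (a := d + 3) (b := d + 2) (by omega)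
      (fun j => if j = d + 1 then v - (i + 1) else if j = d + 3 then g (G i) else R i j)
      w [] o).cast (s'' := ⟨R (i + 1), w, [], o⟩) rfl
      (Store.mk_congr fun j => by simp only [update_apply]; grind) le_rfl
    refine (b₁.seq (b₂.seq b₃)).mono ?_
    have := hgi i
    simp
    omega
  · simp [Test.holds]
    grind

theorem RunsIn.bind {a f : Expr} {A F VA VF : Polynomial ℕ} (hA : a.RunsIn A) (hF : f.RunsIn F)
    (hVA : ∀ w l M, (∀ x ∈ l, x ≤ M) → a.eval w l ≤ VA.eval M)
    (hVF : ∀ w l M, (∀ x ∈ l, x ≤ M) → f.eval w l ≤ VF.eval M) :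
    (bind a f).RunsIn (A + (F.comp (VA + .X) + (2 * VA + 1 + (3 * VF.comp (VA + .X) + 1)))) := by
  intro ρ l d M r r' w o hρ hl hM hr hr'
  have hv := hVA w l M hM
  obtain ⟨v, hv'⟩ : ∃ v, v = a.eval w l := ⟨_, rfl⟩
  rw [← hv'] at hv
  have hM' : ∀ x ∈ v :: l, x ≤ VA.eval M + M := by
    intro x hx
    rcases List.mem_cons.1 hx with rfl | hx
    · omega
    · have := hM x hx
      omega
  have hy := hVF w _ _ hM'
  obtain ⟨y, hy'⟩ : ∃ y, y = f.eval w (v :: l) := ⟨_, rfl⟩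
  rw [← hy'] at hy
  have hev : eval w (Expr.bind a f) l = y := by simp [eval, hy', hv']
  let R₁ : ℕ → ℕ := fun j => if j = d + 1 then v else r j
  let R₂ : ℕ → ℕ := fun j => if j = d + 1 then v else if j = d + 2 then y else r j
  let R₃ : ℕ → ℕ := fun j => if j = d + 2 then y else r j
  have h₁ := hA ρ l (d + 1) M r R₁ w o (by grind) hl hM (by grind) (by grind)
  have h₂ := hF ((d + 1) :: ρ) (v :: l) (d + 2) _ R₁ R₂ w o (by grind) (by
    rw [List.map_cons, List.map_eq_of_eqOn_lt hl hρ (by grind)]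
    grind) hM' (by grind) (by grind)
  have h₃ := (run_clear (d + 1) R₂ w [] o).cast (s'' := ⟨R₃, w, [], o⟩) (t' := 2 * v + 1) rfl
    (Store.mk_congr fun j => by simp only [update_apply]; grind) (by grind)
  have h₄ := (run_move (a := d + 2) (b := d) (by omega) R₃ w [] o).cast
    (s'' := ⟨r', w, [], o⟩) (t' := 3 * y + 1) rfl
    (Store.mk_congr fun j => by simp only [update_apply]; grind) (by grind)
  refine (h₁.seq (h₂.seq (h₃.seq h₄))).mono ?_
  simp only [Polynomial.eval_add, Polynomial.eval_mul, Polynomial.eval_comp,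
    Polynomial.eval_X, Polynomial.eval_one, Polynomial.eval_ofNat]
  gcongr

theorem RunsIn.take {f : Expr} {F : Polynomial ℕ} (hF : f.RunsIn F) (k : ℕ) :
    (take k f).RunsIn F := by
  intro ρ l d M r r' w o hρ hl hM hr hr'
  exact hF (ρ.take k) (l.take k) d M r r' w o (fun i hi => hρ i (List.mem_of_mem_take hi))
    (by rw [← hl, List.map_take]) (fun i hi => hM i (List.mem_of_mem_take hi)) hr hr'

theorem RunsIn.drop {f : Expr} {F : Polynomial ℕ} (hF : f.RunsIn F) (k : ℕ) :
    (drop k f).RunsIn F := by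
  intro ρ l d M r r' w o hρ hl hM hr hr'
  exact hF (ρ.drop k) (l.drop k) d M r r' w o (fun i hi => hρ i (List.mem_of_mem_drop hi))
    (by rw [← hl, List.map_drop]) (fun i hi => hM i (List.mem_of_mem_drop hi)) hr hr'

theorem exists_runsIn (e : Expr) : ∃ T : Polynomial ℕ, e.RunsIn T := by
  induction e with
  | one => exact ⟨_, runsIn_one⟩
  | var i => exact ⟨_, runsIn_var i⟩
  | add a b ha hb => exact ⟨_, ha.choose_spec.add hb.choose_spec⟩
  | bit a ha => exact ⟨_, ha.choose_spec.bit a.exists_eval_le.choose_spec⟩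
  | sum c b hc hb =>
    exact ⟨_, hc.choose_spec.sum hb.choose_spec c.exists_eval_le.choose_spec
      b.exists_eval_le.choose_spec⟩
  | desc c a b hc ha hb =>
    exact ⟨_, hc.choose_spec.desc ha.choose_spec hb.choose_spec c.exists_eval_le.choose_spec
      a.exists_eval_le.choose_spec b.exists_eval_le.choose_spec⟩
  | bind a f ha hf =>
    exact ⟨_, ha.choose_spec.bind hf.choose_spec a.exists_eval_le.choose_spec
      f.exists_eval_le.choose_spec⟩
  | take k f hf => exact ⟨_, hf.choose_spec.take k⟩
  | drop k f hf => exact ⟨_, hf.choose_spec.drop k⟩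

end Expr

/-! ### Machines for terms -/

/-- The increment of a binary number, least significant digit first. -/
def binSucc : List Bool → List Bool
  | [] => [true]
  | false :: l => true :: l
  | true :: l => false :: binSucc l

theorem encodePosNum_succ (n : PosNum) :
    Computability.encodePosNum n.succ = binSucc (Computability.encodePosNum n) := by
  induction n with
  | one => rfl
  | bit0 n _ => rfl
  | bit1 n ih => simp [PosNum.succ, Computability.encodePosNum, binSucc, ih]

theorem encodeNat_succ (n : ℕ) :
    Computability.encodeNat (n + 1) = binSucc (Computability.encodeNat n) := by
  simp only [Computability.encodeNat, Nat.cast_succ, Num.add_one]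
  cases (n : Num) with
  | zero => rfl
  | pos n => exact encodePosNum_succ n

/-- The program that increments the binary number on the output stack, with register `2` as scratch
memory. -/
def Prog.binIncr : Prog :=
  seq (whl .outTrue (seq (act .popOut) (act (.inc 2)))) (seq (act .popOut)
    (seq (act (.pushOut true)) (whl (.pos 2) (seq (act (.dec 2)) (act (.pushOut false))))))

/-- This isolates the carry: the `j` low ones become zeros, and the next digit becomes one. Taking
`l'.tail` treats a zero digit and a missing digit alike. -/
theorem exists_binSucc_eq (l : List Bool) : ∃ (j : ℕ) (l' : List Bool), l'.head? ≠ some true ∧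
    l = List.replicate j true ++ l' ∧ binSucc l = List.replicate j false ++ true :: l'.tail := by
  induction l with
  | nil => exact ⟨0, [], by simp [binSucc]⟩
  | cons b l ih =>
    cases b with
    | false => exact ⟨0, false :: l, by simp [binSucc]⟩
    | true =>
      obtain ⟨j, l', h, h₁, h₂⟩ := ih
      exact ⟨j + 1, l', h, by simp [List.replicate_succ, ← h₁],
        by simp [List.replicate_succ, binSucc, ← h₂]⟩

open Function in
theorem Prog.run_binIncr (r : ℕ → ℕ) (hr : r 2 = 0) (u v : List (Option Bool)) (o : List Bool) :
    Run binIncr ⟨r, u, v, o⟩ (6 * o.length + 4) ⟨r, u, v, binSucc o⟩ := by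
  obtain ⟨j, l, hl, rfl, h₂⟩ := exists_binSucc_eq o
  rw [h₂]
  have hu : update r 2 0 = r := by rw [← hr, update_eq_self]
  have a₁ := run_whl_iterate (b := .outTrue) (p := seq (act .popOut) (act (.inc 2))) 2 j
    (fun i => ⟨update r 2 i, u, v, List.replicate (j - i) true ++ l⟩) ?_ ?_
  · have a₂ := run_whl_iterate (b := .pos 2) (p := seq (act (.dec 2)) (act (.pushOut false))) 2 j
      (fun i => ⟨update r 2 (j - i), u, v, List.replicate i false ++ true :: l.tail⟩) ?_ ?_
    · refine (a₁.seq ((Run.act _ _).seq ((Run.act _ _).seq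
        (a₂.cast (by simp [Act.apply]) rfl le_rfl)))).cast ?_ ?_ ?_
      · simp [hu]
      · simp [hu]
      · simp
        omega
    · intro i hi
      refine ⟨by simp [Test.holds]; omega, ?_⟩
      refine ((Run.act _ _).seq (Run.act _ _)).cast rfl ?_ le_rfl
      simp only [Act.apply, Store.mk.injEq, true_and]
      refine ⟨funext fun j => ?_, by simp [List.replicate_succ]⟩
      simp only [update_apply]
      grind
    · simp [Test.holds]
  · intro i hi
    obtain ⟨k, hk⟩ : ∃ k, j - i = k + 1 := ⟨j - i - 1, by omega⟩
    have hk' : j - (i + 1) = k := by omega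
    refine ⟨by simp [Test.holds, hk, List.replicate_succ], ?_⟩
    refine ((Run.act _ _).seq (Run.act _ _)).cast rfl ?_ le_rfl
    simp [Act.apply, hk, hk', List.replicate_succ]
  · simpa [Test.holds] using hl

theorem length_binSucc_le (l : List Bool) : (binSucc l).length ≤ l.length + 1 := by
  obtain ⟨j, l', -, h₁, h₂⟩ := exists_binSucc_eq l
  rw [h₂, h₁]
  simp
  omega

/-- A logarithmic bound is not needed, because the values of terms are already polynomially bounded.
-/
theorem length_encodeNat_le (n : ℕ) : (Computability.encodeNat n).length ≤ n := by
  induction n with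
  | zero => rfl
  | succ n ih =>
    rw [encodeNat_succ]
    exact (length_binSucc_le _).trans (by omega)

/-- The program that evaluates a term at the length of the input word and writes the value to the
output stack in binary. -/
def Expr.toProg (e : Expr) : Prog :=
  seq (whl .ahead (seq (act .advance) (act (.inc 0)))) (seq (whl .behind (act .retreat))
    (seq (e.compile [0] 1) (seq (whl (.pos 1) (seq (act (.dec 1)) binIncr))
      (seq (whl .ahead (act .discard)) (whl (.pos 0) (act (.dec 0)))))))

theorem Expr.exists_run_toProg (e : Expr) : ∃ T : Polynomial ℕ, ∀ w : List (Option Bool),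
    Run e.toProg ⟨fun _ => 0, w, [], []⟩ (T.eval w.length)
      ⟨fun _ => 0, [], [], Computability.encodeNat (e.eval w [w.length])⟩ := by
  obtain ⟨T, hT⟩ := e.exists_runsIn
  obtain ⟨V, hV⟩ := e.exists_eval_le
  -- The summands pay for measuring the word, rewinding, evaluating the term, converting to binary
  -- by repeated increments, erasing the word, and clearing register `0`. The last two are there
  -- because only the output stack may be nonempty at the end.
  refine ⟨(3 * .X + 1) + ((2 * .X + 1) + (T + ((V * (6 * V + 6) + 1) + ((2 * .X + 1) +
    (2 * .X + 1))))), fun w => ?_⟩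
  obtain ⟨n, hn⟩ : ∃ n, n = w.length := ⟨_, rfl⟩
  obtain ⟨y, hy⟩ : ∃ y, y = e.eval w [w.length] := ⟨_, rfl⟩
  have hyV : y ≤ V.eval n := hy ▸ hV w _ n (by simp [hn])
  let R : ℕ → ℕ → ℕ := fun y j => if j = 0 then n else if j = 1 then y else 0
  have h₁ := run_whl_iterate (b := .ahead) (p := seq (act .advance) (act (.inc 0))) 2 n
    (fun i => ⟨fun j => if j = 0 then i else 0, w.drop i, (w.take i).reverse, []⟩) ?_ ?_
  · have h₂ := (run_rewind (R 0) [] w.reverse []).cast (s'' := ⟨R 0, w, [], []⟩)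
      (s := ⟨fun j => if j = 0 then n else 0, w.drop n, (w.take n).reverse, []⟩)
      (t' := 2 * n + 1) (by simp [R, hn]) (by simp) (by simp [hn])
    have h₃ := hT [0] [n] 1 n (R 0) (R y) w [] (by simp) (by simp [R]) (by simp) (by grind)
      (by grind)
    have h₄ := run_whl_iterate (b := .pos 1) (p := seq (act (.dec 1)) binIncr)
      (6 * y + 5) y (fun i => ⟨R (y - i), w, [], Computability.encodeNat i⟩) ?_ ?_
    · have h₅ := run_whl_iterate (b := .ahead) (p := act .discard) 1 n
        (fun i => ⟨R 0, w.drop i, [], Computability.encodeNat y⟩) ?_ ?_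
      · have h₆ := (run_clear 0 (R 0) [] [] (Computability.encodeNat y)).cast
          (s := ⟨R 0, w.drop n, [], Computability.encodeNat y⟩)
          (s'' := ⟨fun _ => 0, [], [], Computability.encodeNat y⟩) (t' := 2 * n + 1)
          (by simp [hn]) (Store.mk_congr fun j => by simp only [Function.update_apply]; grind)
          (by simp [R])
        rw [← hy, ← hn]
        simp only [Nat.sub_self] at h₄
        refine (h₁.seq (h₂.seq (h₃.seq ((h₄.cast rfl rfl le_rfl).seq
          ((h₅.cast (by simp) rfl le_rfl).seq h₆))))).cast (by simp) rfl ?_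
        simp only [Polynomial.eval_add, Polynomial.eval_mul, Polynomial.eval_X,
          Polynomial.eval_one, Polynomial.eval_ofNat]
        nlinarith [Nat.mul_le_mul hyV hyV]
      · intro i hi
        refine ⟨by simp [Test.holds]; omega, (Run.act _ _).cast rfl ?_ le_rfl⟩
        simp [Act.apply]
      · simp [Test.holds, hn]
    · intro i hi
      refine ⟨by simp [Test.holds, R]; omega, ?_⟩
      have b₁ := (Run.act (.dec 1) ⟨R (y - i), w, [], Computability.encodeNat i⟩).cast
        (s'' := ⟨R (y - (i + 1)), w, [], Computability.encodeNat i⟩) rfl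
        (Store.mk_congr fun j => by simp only [Function.update_apply]; grind) le_rfl
      refine (b₁.seq (run_binIncr _ (by simp [R]) w [] _)).cast rfl (by rw [encodeNat_succ]) ?_
      have := length_encodeNat_le i
      omega
    · simp [Test.holds, R]
  · intro i hi
    have hi' : i < w.length := hn ▸ hi
    refine ⟨by simp [Test.holds]; omega, ?_⟩
    refine ((Run.act _ _).seq (Run.act _ _)).cast rfl ?_ le_rfl
    simp only [Act.apply, Store.mk.injEq, and_true]
    refine ⟨funext fun j => ?_, by simp, ?_⟩
    · simp only [Function.update_apply]
      grind
    · rw [List.take_add_one, List.reverse_append]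
      simp [hi']
  · simp [Test.holds, hn]

/-- Values of terms are computable in polynomial time. -/
theorem Expr.computable {α : Type} (ea : α → List (Option Bool)) (e : Expr) :
    Nonempty (Turing.TM2ComputableInPolyTime ea Computability.encodeNat
      fun a => e.eval (ea a) [(ea a).length]) := by
  obtain ⟨T, hT⟩ := e.exists_run_toProg
  exact Prog.computable ea _ _ e.toProg T fun a => hT (ea a)

/-! ### Derived terms -/

namespace Expr

variable (w : List (Option Bool)) (a b c d e f : Expr) (l : List ℕ)

/-- The constant `0`. -/
def zero : Expr := take 0 (var 0)

/-- Truncated subtraction. -/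
def sub : Expr := desc b a one

/-- Multiplication. -/
def mul : Expr := sum a (drop 1 b)

/-- Squaring. -/
def sq : Expr := bind a (mul (var 0) (var 0))

/-- Negation of truth values. -/
def neg : Expr := sub one a

/-- The truth value of `a ≤ b`. -/
def le : Expr := neg (sub a b)

/-- The truth value of `a < b`. -/
def lt : Expr := le (add a one) b

/-- The truth value of `a = b`. -/
def eq : Expr := neg (add (sub a b) (sub b a))

/-- The truth value of the statement that `b` holds for all values below `c` of a new variable. -/
def all (c b : Expr) : Expr := neg (sum c (neg b))

/-- The truth value of the statement that `b` holds for some value below `c` of a new variable. -/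
def ex (c b : Expr) : Expr := neg (neg (sum c b))

/-- Division by a positive number. -/
def div : Expr := sum a (le (mul (add (var 0) one) (drop 1 b)) (drop 1 a))

/-- The remainder modulo a positive number. -/
def mod : Expr := sub a (mul b (div a b))

/-- Division of `a` by the `e`-th power of the positive number `b`. -/
def divPow : Expr := desc e a (sub (var 0) (div (var 0) (drop 1 b)))

/-- Application of a term in four variables. -/
def app₄ : Expr := bind d (bind (drop 1 c) (bind (drop 2 b) (bind (drop 3 a) (take 4 f))))

@[simp] theorem eval_one : eval w one l = 1 := rfl

@[simp] theorem eval_var (i : ℕ) : eval w (var i) l = l.getD i 0 := rfl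

@[simp] theorem eval_add : eval w (add a b) l = eval w a l + eval w b l := rfl

@[simp] theorem eval_bit :
    eval w (bit a) l = if w[eval w a l]? = some (some true) then 1 else 0 := rfl

@[simp] theorem eval_sum :
    eval w (sum c b) l = ∑ i ∈ Finset.range (eval w c l), eval w b (i :: l) := rfl

@[simp] theorem eval_bind : eval w (bind a f) l = eval w f (eval w a l :: l) := rfl

@[simp] theorem eval_take (k : ℕ) : eval w (take k f) l = eval w f (l.take k) := rfl

@[simp] theorem eval_drop (k : ℕ) : eval w (drop k f) l = eval w f (l.drop k) := rfl

@[simp] theorem eval_zero : eval w zero l = 0 := by simp [zero]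

@[simp] theorem eval_sub : eval w (sub a b) l = eval w a l - eval w b l := by
  simp only [sub, eval]
  generalize eval w b l = n
  induction n with
  | zero => rfl
  | succ n ih =>
    rw [Function.iterate_succ_apply', ih]
    omega

@[simp] theorem eval_mul : eval w (mul a b) l = eval w a l * eval w b l := by simp [mul]

@[simp] theorem eval_sq : eval w (sq a) l = eval w a l ^ 2 := by simp [sq, pow_two]

@[simp] theorem eval_neg : eval w (neg a) l = if eval w a l = 0 then 1 else 0 := by
  simp only [neg, eval_sub, eval_one]
  split_ifs <;> omega

@[simp] theorem eval_le : eval w (le a b) l = if eval w a l ≤ eval w b l then 1 else 0 := by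
  simp [le, Nat.sub_eq_zero_iff_le]

@[simp] theorem eval_lt : eval w (lt a b) l = if eval w a l < eval w b l then 1 else 0 := by
  simp [lt]

theorem eval_neg_ne_zero : eval w (neg a) l ≠ 0 ↔ ¬eval w a l ≠ 0 := by simp

theorem eval_add_ne_zero : eval w (add a b) l ≠ 0 ↔ eval w a l ≠ 0 ∨ eval w b l ≠ 0 := by
  simp
  tauto

theorem eval_mul_ne_zero : eval w (mul a b) l ≠ 0 ↔ eval w a l ≠ 0 ∧ eval w b l ≠ 0 := by simp

theorem eval_le_ne_zero : eval w (le a b) l ≠ 0 ↔ eval w a l ≤ eval w b l := by simp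

theorem eval_eq_ne_zero : eval w (eq a b) l ≠ 0 ↔ eval w a l = eval w b l := by
  simp only [eq, eval_neg_ne_zero, eval_add, eval_sub]
  omega

theorem eval_all_ne_zero (c b : Expr) : eval w (all c b) l ≠ 0 ↔
    ∀ i < eval w c l, eval w b (i :: l) ≠ 0 := by
  simp [all]

theorem eval_ex_ne_zero (c b : Expr) : eval w (ex c b) l ≠ 0 ↔
    ∃ i < eval w c l, eval w b (i :: l) ≠ 0 := by
  simp [ex]

/-- The indices `i` with (i+1)y ≤ x are exactly those below x / y, and for y > 0 they all lie in the
summation range. -/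
theorem eval_div (h : 0 < eval w b l) : eval w (div a b) l = eval w a l / eval w b l := by
  simp only [div, eval_sum, eval_le, eval_mul, eval_add, eval_var, eval_one, eval_drop,
    List.drop_succ_cons, List.drop_zero, List.getD_cons_zero]
  generalize eval w a l = x
  rw [Finset.sum_ite, Finset.sum_const_zero, add_zero, Finset.sum_const, smul_eq_mul, mul_one]
  have : (Finset.range x).filter (fun i => (i + 1) * eval w b l ≤ x) =
      Finset.range (x / eval w b l) := by
    ext i
    simp only [Finset.mem_filter, Finset.mem_range, ← Nat.succ_le_iff (m := i),
      Nat.le_div_iff_mul_le h, Nat.succ_eq_add_one]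
    refine ⟨fun hi => hi.2, fun hi => ⟨?_, hi⟩⟩
    exact (Nat.le_mul_of_pos_right _ h).trans hi
  rw [this, Finset.card_range]

theorem eval_mod (h : 0 < eval w b l) : eval w (mod a b) l = eval w a l % eval w b l := by
  simp only [mod, eval_sub, eval_mul, eval_div _ _ _ _ h]
  have := Nat.div_add_mod (eval w a l) (eval w b l)
  omega

/-- Each pass turns `x` into x - (x - x/b) = x/b. The power is never formed; with a variable
exponent it would break the polynomial bound on values. -/
theorem eval_divPow (h : 0 < eval w b l) :
    eval w (divPow a b e) l = eval w a l / eval w b l ^ eval w e l := by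
  simp only [divPow, eval, eval_sub, eval_div _ (var 0) (drop 1 b) (_ :: l) h]
  generalize eval w e l = n
  induction n with
  | zero => simp
  | succ n ih =>
    rw [Function.iterate_succ_apply', ih, pow_succ, ← Nat.div_div_eq_div_mul]
    simp only [List.getD_cons_zero, List.drop_succ_cons, List.drop_zero]
    exact Nat.sub_sub_self (Nat.div_le_self _ _)

@[simp] theorem eval_app₄ : eval w (app₄ a b c d f) l =
    eval w f [eval w a l, eval w b l, eval w c l, eval w d l] := by
  simp [app₄]

end Expr

/-! ### The approximation algorithm -/

/-- The entry at position `(j, a)` of the matrix with `s` columns and entries at most `s` whose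
entries are the digits of `c` to base `s + 1`. -/
def matrixEntry (s c j a : ℕ) : ℕ := c / (s + 1) ^ (j * s + a) % (s + 1)

/-- The first `k` rows of the matrix of `c` describe threshold subgraphs that cover all edges
meeting the block `b` of `s` consecutive vertices. Row `j` describes the graph in which the vertices
of positive rank form a clique, and are joined to those other vertices that are neighbours of all
vertices of at least the same rank. -/
def IsBlockCover (adj : ℕ → ℕ → Prop) (n s b k c : ℕ) : Prop :=
  (∀ j < k, ∀ a < s, ∀ a' < s, a ≠ a' → matrixEntry s c j a ≠ 0 → matrixEntry s c j a' ≠ 0 →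
    adj (b * s + a) (b * s + a')) ∧
  ∀ a < s, ∀ v < n, adj (b * s + a) v → ∃ j < k, matrixEntry s c j a ≠ 0 ∧
    ∀ a' < s, matrixEntry s c j a ≤ matrixEntry s c j a' →
      adj (b * s + a') v ∨ b * s + a' = v

open Classical in
/-- The number of rows, at most `s`, that are needed to cover a block by a matrix with code below
`N`. -/
noncomputable def blockCount (adj : ℕ → ℕ → Prop) (n N s b : ℕ) : ℕ :=
  ∑ k ∈ Finset.range s, if ∀ k' < k + 1, ∀ c < N, ¬IsBlockCover adj n s b k' c then 1 else 0

/-- The bound on the codes of the matrices. -/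
def codeBound (n : ℕ) : ℕ := n ^ 256

/-- The size of the blocks. -/
def blockSize (n : ℕ) : ℕ :=
  ∑ j ∈ Finset.range n, if (j + 2) ^ (j + 1) ^ 2 ≤ codeBound n then 1 else 0

/-- The value computed by the algorithm. -/
noncomputable def thresholdApprox (adj : ℕ → ℕ → Prop) (n : ℕ) : ℕ :=
  ∑ b ∈ Finset.range n, blockCount adj n (codeBound n) (blockSize n) b

namespace Expr

/-- The number of vertices, in terms of the length of the adjacency matrix. -/
def orderTerm : Expr := sum (var 0) (lt (mul (var 0) (add (var 0) one)) (var 1))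

/-- The bound on the codes, in terms of the order. -/
def codeBoundTerm : Expr := sq (sq (sq (sq (sq (sq (sq (sq (var 0))))))))

/-- The size of the blocks, in terms of the bound on the codes and the order. -/
def blockSizeTerm : Expr :=
  sum (var 1) (le one (divPow (var 1) (add (var 0) (add one one)) (sq (add (var 0) one))))

/-- The matrix entries. -/
def matrixEntryTerm : Expr :=
  mod (divPow (var 1) (add (var 0) one) (add (mul (var 2) (var 0)) (var 3))) (add (var 0) one)

/-- The truth value of the adjacency of `a` and `b`, in terms of the order `c`. -/
def adjTerm : Expr → Expr → Expr → Expr := fun a b c => bit (add (mul a (add c one)) b)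

/-- The first condition on covers of blocks; the variables are the code, the number of rows, a bound
on this number, the block, the block size, the bound on the codes, and the order. -/
def cliqueTerm : Expr :=
  all (var 1) (all (var 5) (all (var 6)
    (add (eq (var 1) (var 0))
      (add (eq (app₄ (var 7) (var 3) (var 2) (var 1) matrixEntryTerm) zero)
        (add (eq (app₄ (var 7) (var 3) (var 2) (var 0) matrixEntryTerm) zero)
          (adjTerm (add (mul (var 6) (var 7)) (var 1)) (add (mul (var 6) (var 7)) (var 0))
            (var 9)))))))

/-- The second condition on covers of blocks. -/
def coverTerm : Expr :=
  all (var 4) (all (var 7)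
    (add (neg (adjTerm (add (mul (var 5) (var 6)) (var 1)) (var 0) (var 8)))
      (ex (var 3)
        (mul (app₄ (var 7) (var 3) (var 0) (var 2) matrixEntryTerm)
          (all (var 7)
            (add (neg (le (app₄ (var 8) (var 4) (var 1) (var 3) matrixEntryTerm)
                (app₄ (var 8) (var 4) (var 1) (var 0) matrixEntryTerm)))
              (add (adjTerm (add (mul (var 7) (var 8)) (var 0)) (var 2) (var 10))
                (eq (add (mul (var 7) (var 8)) (var 0)) (var 2)))))))))

/-- The algorithm, in terms of the block size, the bound on the codes, and the order. -/
def approxTerm : Expr :=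
  sum (var 2) (sum (var 1)
    (all (add (var 0) one) (all (var 4) (neg (mul cliqueTerm coverTerm)))))

/-- The algorithm, in terms of the length of the adjacency matrix. -/
def thresholdTerm : Expr := bind orderTerm (bind codeBoundTerm (bind blockSizeTerm approxTerm))

variable (w : List (Option Bool)) (l : List ℕ)

theorem eval_matrixEntryTerm (s c j a : ℕ) :
    eval w matrixEntryTerm [s, c, j, a] = matrixEntry s c j a := by
  rw [matrixEntryTerm, eval_mod _ _ _ _ (by simp), eval_divPow _ _ _ _ _ (by simp)]
  simp [matrixEntry]

theorem eval_adjTerm_ne_zero (a b c : Expr) : eval w (adjTerm a b c) l ≠ 0 ↔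
    w[eval w a l * (eval w c l + 1) + eval w b l]? = some (some true) := by
  simp [adjTerm]

/-- The adjacency matrix has `n` rows of `n + 1` symbols, and i(i+1) < n(n+1) holds exactly for i <
n. -/
theorem eval_orderTerm (n : ℕ) : eval w orderTerm [n * (n + 1)] = n := by
  simp only [orderTerm, eval_sum, eval_lt, eval_mul, eval_add, eval_var, eval_one,
    List.getD_cons_zero, List.getD_cons_succ]
  rw [Finset.sum_ite, Finset.sum_const_zero, add_zero, Finset.sum_const, smul_eq_mul, mul_one]
  have : (Finset.range (n * (n + 1))).filter (fun i => i * (i + 1) < n * (n + 1)) =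
      Finset.range n := by
    ext i
    simp only [Finset.mem_filter, Finset.mem_range]
    constructor
    · rintro ⟨-, h⟩
      by_contra! hi
      exact absurd h (not_lt.2 (by gcongr))
    · intro h
      exact ⟨by nlinarith, by gcongr⟩
  rw [this, Finset.card_range]

theorem eval_codeBoundTerm (n : ℕ) : eval w codeBoundTerm (n :: l) = codeBound n := by
  simp [codeBoundTerm, codeBound, ← pow_mul]

/-- The test p ≤ N for a possibly huge power p is made in the form 1 ≤ N / p, which `divPow` can
evaluate. -/
theorem eval_blockSizeTerm (n : ℕ) :
    eval w blockSizeTerm (codeBound n :: n :: l) = blockSize n := by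
  simp only [blockSizeTerm, eval_sum, eval_le]
  refine Finset.sum_congr (by simp) fun j _ => ?_
  rw [eval_divPow _ _ _ _ _ (by simp)]
  simp only [eval_one, eval_var, eval_add, eval_sq, List.getD_cons_zero, List.getD_cons_succ]
  congr 1
  rw [Nat.le_div_iff_mul_le (by positivity), one_mul]

theorem eval_mul_cliqueTerm_coverTerm (n N s b m k c : ℕ) (adj : ℕ → ℕ → Prop)
    (hadj : ∀ u v, adj u v ↔ w[u * (n + 1) + v]? = some (some true)) :
    eval w (mul cliqueTerm coverTerm) (c :: k :: m :: b :: s :: N :: n :: l) ≠ 0 ↔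
      IsBlockCover adj n s b k c := by
  simp only [eval_mul_ne_zero, cliqueTerm, coverTerm, eval_all_ne_zero, eval_ex_ne_zero,
    eval_add_ne_zero, eval_neg_ne_zero, eval_le_ne_zero, eval_eq_ne_zero, eval_adjTerm_ne_zero]
  simp only [eval_app₄, eval_matrixEntryTerm, eval_var, eval_add, eval_mul, eval_zero,
    List.getD_cons_zero, List.getD_cons_succ, IsBlockCover, hadj, imp_iff_not_or, ne_eq, not_not]

theorem eval_thresholdTerm (n : ℕ) (adj : ℕ → ℕ → Prop)
    (hadj : ∀ u v, adj u v ↔ w[u * (n + 1) + v]? = some (some true)) :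
    eval w thresholdTerm [n * (n + 1)] = thresholdApprox adj n := by
  simp only [thresholdTerm, eval_bind, eval_orderTerm, eval_codeBoundTerm, eval_blockSizeTerm,
    approxTerm, eval_sum, thresholdApprox]
  refine Finset.sum_congr (by simp) fun b _ => Finset.sum_congr (by simp) fun k _ => ?_
  classical
  -- The value is always 0 or 1, so it is the indicator of being nonzero.
  have h01 : ∀ e l, eval w (all (add (var 0) one) e) l =
      if eval w (all (add (var 0) one) e) l ≠ 0 then 1 else 0 := by
    intro e l
    split_ifs with h
    · simp only [all, eval_neg] at h ⊢
      split_ifs at h ⊢ <;> trivial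
    · simpa using h
  rw [h01]
  refine if_congr ?_ rfl rfl
  simp only [eval_all_ne_zero, eval_neg_ne_zero, eval_mul_cliqueTerm_coverTerm w _ n _ _ b k _ _
    adj hadj]
  rfl

end Expr

/-! ### Soundness of the algorithm -/

namespace SimpleGraph

theorem hasThresholdCover_card {V ι : Type*} [Fintype ι] {G : SimpleGraph V}
    (T : ι → SimpleGraph V) (hT : ∀ i, (T i).IsThreshold) (hG : ∀ i, T i ≤ G)
    (hc : ∀ u v, G.Adj u v → ∃ i, (T i).Adj u v) : G.HasThresholdCover (Fintype.card ι) := by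
  refine ⟨fun i => T ((Fintype.equivFin ι).symm i), fun i => hT _, ?_⟩
  ext e
  induction e with
  | _ u v =>
    simp only [mem_edgeSet, Set.mem_iUnion]
    constructor
    · intro h
      obtain ⟨i, hi⟩ := hc u v h
      exact ⟨Fintype.equivFin ι i, by simpa using hi⟩
    · rintro ⟨i, hi⟩
      exact hG _ hi

/-- `r` is a rank function whose vertices of positive rank form a clique. -/
def IsCliqueRank {V : Type*} (G : SimpleGraph V) (r : V → ℕ) : Prop :=
  ∀ u v, u ≠ v → r u ≠ 0 → r v ≠ 0 → G.Adj u v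

/-- A vertex `u` of positive rank covers `v` if all vertices whose rank is at least that of `u` are
equal or adjacent to `v`. -/
def RankCovers {V : Type*} (G : SimpleGraph V) (r : V → ℕ) (u v : V) : Prop :=
  r u ≠ 0 ∧ ∀ x, r u ≤ r x → G.Adj x v ∨ x = v

/-- With bound 0, give a vertex of positive rank its rank as weight, and a vertex `v` of rank 0 the
weight `-h v`, where `h v` is one more than the largest rank of a non-neighbour. Two vertices of
positive rank are joined, which the clique condition allows. Two of rank 0 are not, their weights
being strictly negative. In the mixed case `u` is joined to `v` when its rank exceeds those of all
non-neighbours of `v`, so `u` is not one of them. -/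
theorem IsCliqueRank.exists_isThreshold {V : Type*} [Finite V] {G : SimpleGraph V} {r : V → ℕ}
    (hr : G.IsCliqueRank r) : ∃ T : SimpleGraph V, T.IsThreshold ∧ T ≤ G ∧
      ∀ u v, G.Adj u v → G.RankCovers r u v → T.Adj u v := by
  classical
  have := Fintype.ofFinite V
  let h : V → ℕ := fun v => (Finset.univ.filter fun x => ¬G.Adj x v).sup r + 1
  let w : V → ℝ := fun v => if r v = 0 then -(h v : ℝ) else r v
  have hpos : ∀ v, (0 : ℝ) < h v := fun v => by positivity
  have hin : ∀ {u v}, r u ≠ 0 → r v = 0 → (0 ≤ w u + w v ↔ h v ≤ r u) := by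
    intro u v hu hv
    simp only [w, hu, hv, if_true, if_false]
    rw [← sub_eq_add_neg, sub_nonneg, Nat.cast_le]
  have hadj : ∀ {u v}, r u ≠ 0 → r v = 0 → h v ≤ r u → G.Adj u v := by
    intro u v hu hv huv
    by_contra hn
    have : r u ≤ (Finset.univ.filter fun x => ¬G.Adj x v).sup r :=
      Finset.le_sup (f := r) (by simpa using hn)
    have huv' : (Finset.univ.filter fun x => ¬G.Adj x v).sup r + 1 ≤ r u := huv
    omega
  refine ⟨⟨fun u v => u ≠ v ∧ 0 ≤ w u + w v, ⟨fun u v huv => ⟨huv.1.symm, by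
    rw [add_comm]; exact huv.2⟩⟩, ⟨fun u hu => hu.1 rfl⟩⟩, ⟨0, w, fun u v huv => ?_⟩, ?_, ?_⟩
  · simp [huv]
  · rintro u v ⟨huv, h0⟩
    by_cases hu : r u = 0 <;> by_cases hv : r v = 0
    · have hu' := hpos u
      have hv' := hpos v
      simp only [w, hu, hv, if_true] at h0
      linarith
    · rw [add_comm] at h0
      exact (hadj hv hu ((hin hv hu).1 h0)).symm
    · exact hadj hu hv ((hin hu hv).1 h0)
    · exact hr u v huv hu hv
  · rintro u v huv ⟨hu, hc⟩
    refine ⟨huv.ne, ?_⟩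
    by_cases hv : r v = 0
    · rw [hin hu hv]
      refine Nat.succ_le_of_lt ((Finset.sup_lt_iff (Nat.pos_of_ne_zero hu)).2 fun x hx => ?_)
      by_contra! hx'
      rcases hc x hx' with h1 | rfl
      · exact (Finset.mem_filter.1 hx).2 h1
      · exact hu (by omega)
    · simp only [w, hu, hv, if_false]
      positivity

end SimpleGraph

/-- `adj` is the adjacency relation of a graph with vertices `0, …, n - 1`; nothing is said about
pairs whose second entry is not a vertex. -/
structure IsAdjacency {n : ℕ} (adj : ℕ → ℕ → Prop) (G : SimpleGraph (Fin n)) : Prop where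
  iff : ∀ u v : Fin n, adj u v ↔ G.Adj u v
  lt : ∀ u v, v < n → adj u v → u < n

theorem blockCount_le (adj : ℕ → ℕ → Prop) (n N s b : ℕ) : blockCount adj n N s b ≤ s := by
  classical
  refine (Finset.sum_le_card_nsmul _ _ 1 fun k _ => ?_).trans (by simp)
  split_ifs <;> simp

theorem blockCount_le_of_isBlockCover {adj : ℕ → ℕ → Prop} {n N s b k c : ℕ} (hc : c < N)
    (h : IsBlockCover adj n s b k c) : blockCount adj n N s b ≤ k := by
  classical
  calc blockCount adj n N s b ≤ ∑ i ∈ Finset.range s, if i < k then 1 else 0 := by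
        refine Finset.sum_le_sum fun i _ => ?_
        split_ifs with h₁ h₂ h₂
        · rfl
        · exact absurd h (h₁ k (by omega) c hc)
        · simp
        · rfl
    _ ≤ k := by
        rw [Finset.sum_boole]
        refine (Finset.card_le_card (t := Finset.range k) fun i hi => ?_).trans (by simp)
        simpa using (Finset.mem_filter.1 hi).2

/-- The count is the minimum of `s` and the least number of rows of a cover. A further row of the
same code may violate the clique condition, so covers need not persist as `k` grows; quantifying
over all k' ≤ k makes the counted `k` an initial segment nevertheless. -/
theorem exists_isBlockCover_blockCount {adj : ℕ → ℕ → Prop} {n N s b : ℕ}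
    (h : blockCount adj n N s b ≠ s) : ∃ c, IsBlockCover adj n s b (blockCount adj n N s b) c := by
  classical
  have hex : ∃ k, ∃ c < N, IsBlockCover adj n s b k c := by
    by_contra! hn
    refine h ?_
    unfold blockCount
    rw [Finset.sum_congr rfl fun k _ => if_pos fun k' _ c hc => hn k' c hc]
    simp
  obtain ⟨c, hc, hcov⟩ := Nat.find_spec hex
  have hle := blockCount_le_of_isBlockCover hc hcov
  have hge : min s (Nat.find hex) ≤ blockCount adj n N s b := by
    unfold blockCount
    rw [Finset.sum_boole]
    calc min s (Nat.find hex) = (Finset.range (min s (Nat.find hex))).card := by simp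
      _ ≤ _ := by
        refine Finset.card_le_card fun i hi => ?_
        simp only [Finset.mem_range, lt_min_iff, Finset.mem_filter] at hi ⊢
        refine ⟨hi.1, fun k' hk' c hc h' => ?_⟩
        exact Nat.find_min hex (m := k') (by omega) ⟨c, hc, h'⟩
  have := blockCount_le adj n N s b
  have heq : blockCount adj n N s b = Nat.find hex := by
    rcases min_choice s (Nat.find hex) with h' | h' <;> omega
  exact ⟨c, heq ▸ hcov⟩

/-- Ranks vanish outside the block, so both conditions concern only block vertices, where u = b s +
u mod s. -/
theorem exists_ranks_of_isBlockCover {n s b k c : ℕ} {adj : ℕ → ℕ → Prop} {G : SimpleGraph (Fin n)}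
    (hadj : IsAdjacency adj G) (h : IsBlockCover adj n s b k c) :
    ∃ r : Fin k → Fin n → ℕ, (∀ j, G.IsCliqueRank (r j)) ∧
      ∀ u v : Fin n, (u : ℕ) / s = b → 0 < s → G.Adj u v → ∃ j, G.RankCovers (r j) u v := by
  have hdec : ∀ u : Fin n, 0 < s → (u : ℕ) / s = b → b * s + (u : ℕ) % s = u := by
    intro u _ hu
    rw [← hu, mul_comm]
    exact Nat.div_add_mod _ _
  refine ⟨fun j u => if (u : ℕ) / s = b then matrixEntry s c j (u % s) else 0, ?_, ?_⟩
  · intro j u v huv hu hv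
    simp only [ne_eq, ite_eq_right_iff, Classical.not_imp] at hu hv
    rcases Nat.eq_zero_or_pos s with rfl | hs
    -- For `s = 0` the entries are remainders modulo 1, so no rank is positive.
    · simp [matrixEntry, Nat.mod_one] at hu
    have h' := h.1 j j.2 (u % s) (Nat.mod_lt _ hs) (v % s) (Nat.mod_lt _ hs) (fun he => huv ?_)
      hu.2 hv.2
    · rwa [hdec u hs hu.1, hdec v hs hv.1, hadj.iff] at h'
    · have h₁ := hdec u hs hu.1
      have h₂ := hdec v hs hv.1
      exact Fin.ext (by omega)
  · intro u v hu hs huv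
    obtain ⟨j, hj, h₁, h₂⟩ := h.2 (u % s) (Nat.mod_lt _ hs) v v.2
      (by rwa [hdec u hs hu, hadj.iff])
    refine ⟨⟨j, hj⟩, by simpa [hu] using h₁, fun x hx => ?_⟩
    simp only [hu, if_true] at hx
    split_ifs at hx with hxb
    · have := h₂ (x % s) (Nat.mod_lt _ hs) hx
      rwa [hdec x hs hxb, hadj.iff, Fin.val_inj] at this
    · omega

/-- Rank function `j` is positive at the `j`-th vertex of the block only and describes its star.
This serves blocks whose count reaches the cap `s`. -/
theorem exists_ranks_of_size {n s b : ℕ} (G : SimpleGraph (Fin n)) :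
    ∃ r : Fin s → Fin n → ℕ, (∀ j, G.IsCliqueRank (r j)) ∧
      ∀ u v : Fin n, (u : ℕ) / s = b → 0 < s → G.Adj u v → ∃ j, G.RankCovers (r j) u v := by
  refine ⟨fun j u => if (u : ℕ) = b * s + j then 1 else 0, fun j u v huv hu hv => ?_, ?_⟩
  · simp only [ne_eq, ite_eq_right_iff, one_ne_zero, imp_false, not_not] at hu hv
    exact absurd (Fin.ext (hu.trans hv.symm)) huv
  · intro u v hu hs huv
    have hdec : (u : ℕ) = b * s + (u : ℕ) % s := by
      rw [← hu, mul_comm]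
      exact (Nat.div_add_mod _ _).symm
    refine ⟨⟨u % s, Nat.mod_lt _ hs⟩, by simp [← hdec], fun x hx => ?_⟩
    simp only [← hdec, if_true] at hx
    split_ifs at hx with hxu
    · exact Or.inl (Fin.ext hxu ▸ huv)
    · omega

theorem thresholdDim_le_thresholdApprox {n : ℕ} {adj : ℕ → ℕ → Prop} {G : SimpleGraph (Fin n)}
    (hadj : IsAdjacency adj G) (hs : 0 < blockSize n) :
    G.thresholdDim ≤ thresholdApprox adj n := by
  have key : ∀ b, ∃ T : Fin (blockCount adj n (codeBound n) (blockSize n) b) → SimpleGraph (Fin n),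
      (∀ i, (T i).IsThreshold) ∧ (∀ i, T i ≤ G) ∧
      ∀ u v : Fin n, (u : ℕ) / blockSize n = b → G.Adj u v → ∃ i, (T i).Adj u v := by
    intro b
    have : ∃ r : Fin (blockCount adj n (codeBound n) (blockSize n) b) → Fin n → ℕ,
        (∀ j, G.IsCliqueRank (r j)) ∧ ∀ u v : Fin n, (u : ℕ) / blockSize n = b → 0 < blockSize n →
          G.Adj u v → ∃ j, G.RankCovers (r j) u v := by
      by_cases h : blockCount adj n (codeBound n) (blockSize n) b = blockSize n
      · rw [h]
        exact exists_ranks_of_size G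
      · exact exists_ranks_of_isBlockCover hadj (exists_isBlockCover_blockCount h).choose_spec
    obtain ⟨r, hr, hc⟩ := this
    choose T h₁ h₂ h₃ using fun j => (hr j).exists_isThreshold
    refine ⟨T, h₁, h₂, fun u v hu huv => ?_⟩
    obtain ⟨j, hj⟩ := hc u v hu hs huv
    exact ⟨j, h₃ j u v huv hj⟩
  choose T h₁ h₂ h₃ using key
  have hcov := SimpleGraph.hasThresholdCover_card (G := G)
    -- Block numbers below `n` suffice, since u / s ≤ u < n.
    (ι := Σ b : Fin n, Fin (blockCount adj n (codeBound n) (blockSize n) b))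
    (fun x => T x.1 x.2) (fun x => h₁ _ _) (fun x => h₂ _ _) fun u v huv => by
      obtain ⟨i, hi⟩ := h₃ (u / blockSize n) u v rfl huv
      exact ⟨⟨⟨u / blockSize n, (Nat.div_le_self _ _).trans_lt u.2⟩, i⟩, hi⟩
  refine (Nat.sInf_le hcov).trans_eq ?_
  simp [thresholdApprox, Finset.sum_range]

/-! ### The quality of the approximation -/

theorem Nat.exists_digits (B : ℕ) (hB : 0 < B) (M : ℕ) (g : ℕ → ℕ) (hg : ∀ i < M, g i < B) :
    ∃ c < B ^ M, ∀ i < M, c / B ^ i % B = g i := by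
  induction M generalizing g with
  | zero => exact ⟨0, by simp, by simp⟩
  | succ M ih =>
    obtain ⟨c, hc, h⟩ := ih (fun i => g (i + 1)) fun i hi => hg _ (by omega)
    have hg0 := hg 0 (by omega)
    refine ⟨g 0 + B * c, ?_, fun i hi => ?_⟩
    · calc g 0 + B * c < B * (c + 1) := by rw [Nat.mul_succ]; omega
        _ ≤ B * B ^ M := Nat.mul_le_mul_left _ hc
        _ = B ^ (M + 1) := by ring
    · rcases i with _ | i
      · simpa using Nat.mod_eq_of_lt hg0
      · rw [pow_succ', ← Nat.div_div_eq_div_mul, Nat.add_mul_div_left _ _ hB,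
          Nat.div_eq_of_lt hg0, zero_add]
        exact h i (by omega)

theorem exists_matrixEntry_eq {s : ℕ} (m : ℕ → ℕ → ℕ) (hm : ∀ j a, m j a ≤ s) :
    ∃ c < (s + 1) ^ s ^ 2, ∀ j < s, ∀ a < s, matrixEntry s c j a = m j a := by
  obtain ⟨c, hc, h⟩ := Nat.exists_digits (s + 1) (by omega) (s ^ 2) (fun i => m (i / s) (i % s))
    fun i _ => Nat.lt_succ_of_le (hm _ _)
  refine ⟨c, hc, fun j hj a ha => ?_⟩
  rw [matrixEntry, h _ (by nlinarith)]
  congr 1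
  · rw [mul_comm, Nat.mul_add_div (by omega), Nat.div_eq_of_lt ha, add_zero]
  · rw [mul_comm, Nat.mul_add_mod, Nat.mod_eq_of_lt ha]

/-- Row 2i + γ ranks the block vertices of colour γ, in a 2-colouring of the complement, by their
weights in the `i`-th threshold graph. Colour classes are cliques of G. If uv is an edge of that
graph and `x` ranks at least as high as `u`, then `x` weighs at least as much, so x = v or xv is an
edge too. -/
theorem exists_isBlockCover {n s b t N : ℕ} {adj : ℕ → ℕ → Prop} {G : SimpleGraph (Fin n)}
    (hadj : IsAdjacency adj G) (hG : Gᶜ.IsBipartite) (ht : G.HasThresholdCover t)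
    (hts : 2 * t < s) (hN : (s + 1) ^ s ^ 2 ≤ N) :
    ∃ c < N, IsBlockCover adj n s b (2 * t) c := by
  classical
  obtain ⟨C⟩ := hG
  obtain ⟨T, hT, hE⟩ := ht
  choose S W hW using hT
  let col : ℕ → Fin n → Prop := fun j u => (C u : ℕ) = j % 2
  let wt : ℕ → Fin n → ℝ := fun j u => if h : j / 2 < t then W ⟨j / 2, h⟩ u else 0
  -- One plus the number of strictly lighter block vertices of the same colour turns real weights
  -- into ranks from 1 to `s` in the same order.
  let below : ℕ → Fin n → Finset ℕ := fun j u => (Finset.range s).filter fun a =>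
    ∃ h : b * s + a < n, col j ⟨b * s + a, h⟩ ∧ wt j ⟨b * s + a, h⟩ < wt j u
  let m : ℕ → ℕ → ℕ := fun j a => if h : a < s ∧ b * s + a < n then
    if col j ⟨b * s + a, h.2⟩ then (below j ⟨b * s + a, h.2⟩).card + 1 else 0 else 0
  have hm : ∀ j a, m j a ≤ s := by
    intro j a
    simp only [m]
    split_ifs with h hc
    · refine Nat.succ_le_of_lt ((Finset.card_lt_card (t := Finset.range s) ?_).trans_eq (by simp))
      refine Finset.filter_ssubset.2 ⟨a, by simpa using h.1, ?_⟩
      rintro ⟨_, _, hlt⟩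
      exact lt_irrefl _ hlt
    · simp
    · simp
  have hm0 : ∀ {j a}, m j a ≠ 0 → ∃ h : b * s + a < n, a < s ∧ col j ⟨b * s + a, h⟩ ∧
      m j a = (below j ⟨b * s + a, h⟩).card + 1 := by
    intro j a h
    simp only [m] at h ⊢
    split_ifs at h ⊢ with h₁ h₂
    · exact ⟨h₁.2, h₁.1, h₂, rfl⟩
    · exact absurd rfl h
    · exact absurd rfl h
  have hmono : ∀ {j a a'} (h : b * s + a < n) (h' : b * s + a' < n), m j a ≠ 0 → m j a ≤ m j a' →
      wt j ⟨b * s + a, h⟩ ≤ wt j ⟨b * s + a', h'⟩ := by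
    intro j a a' h h' ha hle
    by_contra! hlt
    obtain ⟨_, has, hca, hma⟩ := hm0 ha
    obtain ⟨_, has', hca', hma'⟩ := hm0 (a := a') (j := j) (by omega)
    refine absurd hle (not_le.2 ?_)
    rw [hma, hma', Nat.add_lt_add_iff_right]
    refine Finset.card_lt_card ⟨fun x hx => ?_, fun hsub => ?_⟩
    · simp only [below, Finset.mem_filter] at hx ⊢
      obtain ⟨hx, hxn, hxc, hxw⟩ := hx
      exact ⟨hx, hxn, hxc, hxw.trans hlt⟩
    · have : a' ∈ below j ⟨b * s + a', h'⟩ :=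
        hsub (by simp only [below, Finset.mem_filter, Finset.mem_range]; exact ⟨has', h', hca', hlt⟩)
      simp only [below, Finset.mem_filter] at this
      obtain ⟨_, _, _, hlt'⟩ := this
      exact lt_irrefl _ hlt'
  obtain ⟨c, hc, hcm⟩ := exists_matrixEntry_eq m hm
  refine ⟨c, hc.trans_le hN, fun j hj a ha a' ha' hne h₁ h₂ => ?_, fun a ha v hv hav => ?_⟩
  · rw [hcm j (by omega) a ha] at h₁
    rw [hcm j (by omega) a' ha'] at h₂
    obtain ⟨hn, -, hcol, -⟩ := hm0 h₁
    obtain ⟨hn', -, hcol', -⟩ := hm0 h₂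
    rw [hadj.iff ⟨_, hn⟩ ⟨_, hn'⟩]
    by_contra hna
    have hne' : (⟨b * s + a, hn⟩ : Fin n) ≠ ⟨b * s + a', hn'⟩ := by
      intro h
      have := Fin.mk.inj h
      omega
    exact C.valid (show Gᶜ.Adj _ _ from (SimpleGraph.compl_adj _ _ _).2 ⟨hne', hna⟩)
      (Fin.ext (hcol.trans hcol'.symm))
  · have hn := hadj.lt _ v hv hav
    have hadj' := (hadj.iff ⟨_, hn⟩ ⟨v, hv⟩).1 hav
    have hmem : s(⟨b * s + a, hn⟩, ⟨v, hv⟩) ∈ ⋃ i, (T i).edgeSet := hE ▸ hadj'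
    obtain ⟨i, hi⟩ := Set.mem_iUnion.1 hmem
    obtain ⟨j, hj⟩ : ∃ j : ℕ, j = 2 * i + (C ⟨b * s + a, hn⟩ : ℕ) := ⟨_, rfl⟩
    have hC := (C ⟨b * s + a, hn⟩).2
    have hi2 := i.2
    have hj2 : j / 2 = i := by omega
    have hwt : wt j = W i := by
      funext u
      simp only [wt, hj2, hi2, dite_true]
    have hcol : col j ⟨b * s + a, hn⟩ := by
      simp only [col]
      omega
    have hma : m j a ≠ 0 := by simp [m, ha, hn, hcol]
    refine ⟨j, by omega, by rwa [hcm j (by omega) a ha], fun a' ha' hle => ?_⟩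
    rw [hcm j (by omega) a ha, hcm j (by omega) a' ha'] at hle
    obtain ⟨hn', -, -, -⟩ := hm0 (j := j) (a := a') (by omega)
    have hw := hmono hn hn' hma hle
    rw [hwt] at hw
    refine or_iff_not_imp_right.2 fun hne => ?_
    have hne' : (⟨b * s + a', hn'⟩ : Fin n) ≠ ⟨v, hv⟩ := fun h => hne (Fin.mk.inj h)
    have h₁ := (hW i _ _ hadj'.ne).1 hi
    have h₂ := (hW i _ _ hne').2 (h₁.trans (by gcongr))
    rw [hadj.iff ⟨_, hn'⟩ ⟨v, hv⟩]
    have : s(⟨b * s + a', hn'⟩, ⟨v, hv⟩) ∈ ⋃ i, (T i).edgeSet := Set.mem_iUnion.2 ⟨i, h₂⟩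
    rwa [← hE] at this

/-- At most `K` blocks contain vertices. Each costs at most 2t: by `exists_isBlockCover` if 2t < s,
and by the cap `s` otherwise. -/
theorem thresholdApprox_le {n K : ℕ} {adj : ℕ → ℕ → Prop} {G : SimpleGraph (Fin n)}
    (hadj : IsAdjacency adj G) (hG : Gᶜ.IsBipartite)
    (hN : (blockSize n + 1) ^ blockSize n ^ 2 ≤ codeBound n) (hK : n ≤ blockSize n * K) :
    thresholdApprox adj n ≤ 2 * K * G.thresholdDim := by
  classical
  have hblock : ∀ b, blockCount adj n (codeBound n) (blockSize n) b ≤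
      if b < K then 2 * G.thresholdDim else 0 := by
    intro b
    split_ifs with hb
    · by_cases h : 2 * G.thresholdDim < blockSize n
      · obtain ⟨c, hc, hcov⟩ := exists_isBlockCover (b := b) hadj hG
          G.hasThresholdCover_thresholdDim h hN
        exact blockCount_le_of_isBlockCover hc hcov
      · exact (blockCount_le _ _ _ _ _).trans (by omega)
    -- A block from `K` on starts beyond the last vertex, so zero rows cover it.
    · refine blockCount_le_of_isBlockCover (c := 0) (lt_of_lt_of_le (by positivity) hN)
        ⟨fun j hj => absurd hj (by omega), fun a ha v hv hav => ?_⟩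
      have := hadj.lt _ v hv hav
      have := Nat.mul_le_mul_left (blockSize n) (not_lt.1 hb)
      rw [mul_comm b] at *
      omega
  calc thresholdApprox adj n ≤ ∑ b ∈ Finset.range n, if b < K then 2 * G.thresholdDim else 0 :=
        Finset.sum_le_sum fun b _ => hblock b
    _ = ((Finset.range n).filter (· < K)).card * (2 * G.thresholdDim) := by
        rw [Finset.sum_ite, Finset.sum_const_zero, add_zero, Finset.sum_const, smul_eq_mul]
    _ ≤ K * (2 * G.thresholdDim) := by
        refine Nat.mul_le_mul_right _ ((Finset.card_le_card (t := Finset.range K)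
          fun i hi => ?_).trans (by simp))
        simpa using (Finset.mem_filter.1 hi).2
    _ = 2 * K * G.thresholdDim := by ring

/-! ### The size of the blocks -/

/-- The powers increase with `j`, so the counted `j` form an initial segment, and the block size is
the first `j` that fails, or `n`. -/
theorem blockSize_spec (n : ℕ) :
    (∀ j < blockSize n, (j + 2) ^ (j + 1) ^ 2 ≤ codeBound n) ∧ blockSize n ≤ n ∧
      (blockSize n < n → codeBound n < (blockSize n + 2) ^ (blockSize n + 1) ^ 2) := by
  classical
  have hmono : ∀ i j : ℕ, i ≤ j → (i + 2) ^ (i + 1) ^ 2 ≤ (j + 2) ^ (j + 1) ^ 2 := fun i j h =>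
    (Nat.pow_le_pow_left (by omega) _).trans
      (Nat.pow_le_pow_right (by omega) (Nat.pow_le_pow_left (by omega) 2))
  have hex : ∃ m, m = n ∨ codeBound n < (m + 2) ^ (m + 1) ^ 2 := ⟨n, Or.inl rfl⟩
  have hm : Nat.find hex ≤ n := Nat.find_min' hex (Or.inl rfl)
  have heq : blockSize n = Nat.find hex := by
    rw [blockSize, Finset.sum_boole]
    have : (Finset.range n).filter (fun j => (j + 2) ^ (j + 1) ^ 2 ≤ codeBound n) =
        Finset.range (Nat.find hex) := by
      ext j
      simp only [Finset.mem_filter, Finset.mem_range]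
      refine ⟨fun ⟨hj, h⟩ => ?_, fun hj => ⟨by omega, ?_⟩⟩
      · by_contra! hle
        rcases Nat.find_spec hex with h' | h'
        · omega
        · exact absurd (h'.trans_le (hmono _ _ hle)) (not_lt.2 h)
      · have := Nat.find_min hex hj
        push Not at this
        exact this.2
    simp [this]
  rw [heq]
  refine ⟨fun j hj => ?_, hm, fun hlt => ?_⟩
  · have := Nat.find_min hex hj
    push Not at this
    exact this.2
  · exact (Nat.find_spec hex).resolve_left hlt.ne

theorem blockSize_pos {n : ℕ} (hn : 2 ≤ n) : 0 < blockSize n := by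
  by_contra! h0
  have h0 : blockSize n = 0 := by omega
  have h := (blockSize_spec n).2.2 (by omega)
  rw [h0, codeBound] at h
  have : n ^ 1 ≤ n ^ 256 := Nat.pow_le_pow_right (by omega) (by omega)
  norm_num at h
  omega

theorem pow_blockSize_le {n : ℕ} (hn : 2 ≤ n) :
    (blockSize n + 1) ^ blockSize n ^ 2 ≤ codeBound n := by
  obtain ⟨k, hk⟩ : ∃ k, blockSize n = k + 1 := ⟨blockSize n - 1, by have := blockSize_pos hn; omega⟩
  rw [hk]
  exact (blockSize_spec n).1 k (by omega)

theorem Real.le_log_three : (1.05 : ℝ) ≤ Real.log 3 := by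
  have h1 : Real.log (3 / Real.exp 1) = Real.log 3 - 1 := by
    rw [Real.log_div (by norm_num) (Real.exp_pos 1).ne', Real.log_exp]
  have h2 := Real.one_sub_inv_le_log_of_pos (x := 3 / Real.exp 1) (by positivity)
  rw [h1, inv_div] at h2
  have := Real.exp_one_lt_d9
  linarith

/-- With x = log n and y = log x the claim is x ≤ s^2 y. The hypothesis gives 256x < (s+1)^2
log(s+2) ≤ 4s^2 log(s+2). If s^2 y < x, then 64y < log(s+2), that is, x^64 < s+2 ≤ 3s. Squaring and
using s^2 y < x again gives x^127 y < 9, which is too small. -/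
theorem le_mul_of_codeBound_lt {n s : ℕ} (hn : 3 ≤ n) (hs : 1 ≤ s)
    (h : codeBound n < (s + 2) ^ (s + 1) ^ 2) :
    (n : ℝ) ≤ s * (n * √(Real.log (Real.log n)) / √(Real.log n)) := by
  obtain ⟨x, hx⟩ : ∃ x, x = Real.log n := ⟨_, rfl⟩
  obtain ⟨y, hy⟩ : ∃ y, y = Real.log x := ⟨_, rfl⟩
  have hn' : (3 : ℝ) ≤ n := by exact_mod_cast hn
  have hs' : (1 : ℝ) ≤ s := by exact_mod_cast hs
  have hx1 : 1.05 ≤ x := hx ▸ Real.le_log_three.trans (Real.log_le_log (by norm_num) hn')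
  have hx0 : 0 < x := by linarith
  have hy0 : 0.04 ≤ y := by
    have h1 := Real.one_sub_inv_le_log_of_pos hx0
    have h2 : x⁻¹ ≤ 1.05⁻¹ := by gcongr
    rw [hy]
    norm_num at h2
    linarith
  rw [← hx, ← hy]
  have hlog : 256 * x < (s + 1) ^ 2 * Real.log (s + 2) := by
    have h1 : (n : ℝ) ^ 256 < ((s : ℝ) + 2) ^ (s + 1) ^ 2 := by exact_mod_cast h
    have h2 := Real.log_lt_log (by positivity) h1
    rw [Real.log_pow, Real.log_pow, ← hx] at h2
    exact_mod_cast h2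
  have main : x ≤ s ^ 2 * y := by
    by_contra! hlt
    have hl0 : 0 < Real.log ((s : ℝ) + 2) := Real.log_pos (by linarith)
    have h1 : 64 * y < Real.log (s + 2) := by
      have h2 : ((s : ℝ) + 1) ^ 2 ≤ 4 * s ^ 2 := by nlinarith
      have h3 : 256 * x * y < 4 * x * Real.log (s + 2) := by
        calc 256 * x * y < ((s + 1) ^ 2 * Real.log (s + 2)) * y := by gcongr
          _ ≤ (4 * s ^ 2 * Real.log (s + 2)) * y := by gcongr
          _ = 4 * (s ^ 2 * y) * Real.log (s + 2) := by ring
          _ ≤ 4 * x * Real.log (s + 2) := by gcongr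
      have h4 : x * (64 * y) < x * Real.log (s + 2) := by linarith
      exact lt_of_mul_lt_mul_left h4 hx0.le
    have h2 : x ^ 64 < s + 2 := by
      rw [hy] at h1
      refine (Real.log_lt_log_iff (by positivity) (by positivity)).1 ?_
      rw [Real.log_pow]
      exact_mod_cast h1
    have h3 : x ^ 128 < 9 * (s : ℝ) ^ 2 := by
      calc x ^ 128 = (x ^ 64) ^ 2 := by ring
        _ < (3 * (s : ℝ)) ^ 2 := by gcongr; linarith
        _ = 9 * (s : ℝ) ^ 2 := by ring
    have h4 : x ^ 127 * y < 9 := by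
      have h5 : x * (x ^ 127 * y) < x * 9 := by
        calc x * (x ^ 127 * y) = x ^ 128 * y := by ring
          _ ≤ 9 * s ^ 2 * y := by gcongr
          _ = 9 * (s ^ 2 * y) := by ring
          _ < x * 9 := by linarith
      exact lt_of_mul_lt_mul_left h5 hx0.le
    -- The left side exceeds 9. The large exponent in `codeBound` makes this work down to n = 3,
    -- where `x` is barely above 1 and `y` is near 0.
    have h5 : (1.05 : ℝ) ^ 127 * 0.04 ≤ x ^ 127 * y := by gcongr
    norm_num at h5 h4
    linarith
  have hsq : √x ≤ s * √y := by
    rw [← Real.sqrt_sq (by positivity : (0 : ℝ) ≤ s), ← Real.sqrt_mul (by positivity)]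
    exact Real.sqrt_le_sqrt main
  have hxs : 0 < √x := Real.sqrt_pos.2 hx0
  rw [← mul_div_assoc, le_div_iff₀ hxs]
  calc (n : ℝ) * √x ≤ n * (s * √y) := by gcongr
    _ = s * (n * √y) := by ring

theorem order_le_blockSize_mul {n : ℕ} (hn : 3 ≤ n) :
    n ≤ blockSize n * ⌈(n : ℝ) * √(Real.log (Real.log n)) / √(Real.log n)⌉₊ := by
  have hs := blockSize_pos (n := n) (by omega)
  obtain ⟨-, hle, hlt⟩ := blockSize_spec n
  -- If s = n there is a single block, and it is enough that the ceiling is positive.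
  rcases hle.eq_or_lt with heq | hlt'
  · rw [heq]
    refine Nat.le_mul_of_pos_right _ (Nat.ceil_pos.2 ?_)
    have hn' : (3 : ℝ) ≤ n := by exact_mod_cast hn
    have h1 : 1 < Real.log n := lt_of_lt_of_le (by norm_num)
      (Real.le_log_three.trans (Real.log_le_log (by norm_num) hn'))
    have h2 := Real.log_pos h1
    positivity
  · have h := le_mul_of_codeBound_lt hn hs (hlt hlt')
    have hcast : (n : ℝ) ≤ (blockSize n *
        ⌈(n : ℝ) * √(Real.log (Real.log n)) / √(Real.log n)⌉₊ : ℕ) := by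
      push_cast
      exact h.trans (by gcongr; exact Nat.le_ceil _)
    exact_mod_cast hcast

/-! ### The adjacency matrix -/

theorem List.getElem?_flatMap_of_length_eq {α β : Type*} (f : α → List β) (m : ℕ) (l : List α)
    (h : ∀ x ∈ l, (f x).length = m) (i j : ℕ) (hj : j < m) :
    (l.flatMap f)[i * m + j]? = l[i]?.bind fun x => (f x)[j]? := by
  induction l generalizing i with
  | nil => simp
  | cons x l ih =>
    have hx := h x (by simp)
    rw [List.flatMap_cons]
    rcases i with _ | i
    · rw [List.getElem?_append_left (by omega)]
      simp
    · rw [List.getElem?_append_right (by rw [hx, Nat.succ_mul]; omega)]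
      have : (i + 1) * m + j - (f x).length = i * m + j := by rw [hx, Nat.succ_mul]; omega
      rw [this, ih fun y hy => h y (by simp [hy])]
      simp

theorem CoBipartiteGraph.length_encode (G : CoBipartiteGraph) :
    G.encode.length = G.order * (G.order + 1) := by
  simp [encode, List.length_flatMap]

theorem CoBipartiteGraph.encode_getElem? (G : CoBipartiteGraph) (u v : ℕ) (hv : v < G.order) :
    G.encode[u * (G.order + 1) + v]? = some (some true) ↔
      ∃ hu : u < G.order, G.graph.Adj ⟨u, hu⟩ ⟨v, hv⟩ := by
  classical
  rw [encode, List.getElem?_flatMap_of_length_eq _ (G.order + 1) _ (by simp) _ _ (by omega)]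
  by_cases hu : u < G.order
  · simp [hu, hv, List.getElem?_append_left]
  · simp [hu]

/-- For v ≥ n the position u(n+1)+v is a row separator, lies in a later row or is past the end, so
the relation is meaningful only for v < n. -/
theorem CoBipartiteGraph.isAdjacency_encode (G : CoBipartiteGraph) :
    IsAdjacency (fun u v => G.encode[u * (G.order + 1) + v]? = some (some true)) G.graph where
  iff u v := by simp [G.encode_getElem? u v v.2]
  lt u v hv h := ((G.encode_getElem? u v hv).1 h).1

/-- There is a function `f` on co-bipartite graphs, computable by a Turing machine in time
polynomial in the length of the input (the adjacency matrix; the output is written in binary),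
whose value approximates the threshold dimension within the factor
`2 ⌈n √(log log n) / √(log n)⌉`, where `n` is the number of vertices. -/
theorem mainTheorem5 :
    ∃ f : CoBipartiteGraph → ℕ,
      Nonempty (Turing.TM2ComputableInPolyTime
        CoBipartiteGraph.encode Computability.encodeNat f) ∧
      ∀ G : CoBipartiteGraph, 3 ≤ G.order →
        G.graph.thresholdDim ≤ f G ∧
        (f G : ℝ) ≤
          2 * (⌈(G.order : ℝ) * √(Real.log (Real.log (G.order : ℝ))) /
                √(Real.log (G.order : ℝ))⌉₊ : ℝ) * (G.graph.thresholdDim : ℝ) := by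
  refine ⟨fun G => Expr.thresholdTerm.eval G.encode [G.encode.length],
    Expr.computable _ _, fun G hn => ?_⟩
  have hval := Expr.eval_thresholdTerm G.encode G.order _ fun u v => Iff.rfl
  simp only [G.length_encode, hval]
  refine ⟨thresholdDim_le_thresholdApprox G.isAdjacency_encode (blockSize_pos (by omega)), ?_⟩
  exact_mod_cast thresholdApprox_le G.isAdjacency_encode G.compl_isBipartite
    (pow_blockSize_le (by omega)) (order_le_blockSize_mul hn)
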